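/- Let $\eta_1=\eta_1(x)$, $\eta_2=\eta_2(y)$ be real smooth functions, and let $\mathcal E$ be the infinite prolongation of the system $$u_{yy}=\frac{\tfrac12\eta_1' v^2v_x+\tfrac12\eta_2' uvu_y+(\eta_1-\eta_2)uu_yv_y+u^2v^3}{uv(\eta_1-\eta_2)},\qquad v_{xx}=\frac{\tfrac12\eta_1' uvv_x+\tfrac12\eta_2' u^2u_y+(\eta_2-\eta_1)vv_xu_x+u^3v^2}{uv(\eta_2-\eta_1)},$$ considered over a connected open set $\Omega$ of values of $(x,y,u,v)$ on which $\eta_1$, $\eta_2$ are smooth, $u\neq0$, $v\neq0$ and $\eta_1(x)\neq\eta_2(y)$. Internal coordinates on $\mathcal E$ are $x$, $y$, $u_{x^i}$, $u_{x^iy}$, $v_{y^j}$, $v_{xy^j}$ $(i,j\ge0)$, with $(x,y,u,v)\in\Omega$ and all other coordinates arbitrary real numbers; $D_x$, $D_y$ denote the total derivatives on $\mathcal E$. Substitute the formal expansion $w=w_0+w_1\mu+w_2\mu^2+\cdots$ with $w_0=e^{\theta_0}$ and $w_k=\theta_ke^{\theta_0}$ $(k>0)$ into $$w_x=i\sqrt{\frac{1+\eta_2\mu^2}{1+\eta_1\mu^2}}\,\frac{u_y}{v}\,w+\frac{u\mu}{2\sqrt{1+\eta_1\mu^2}}(1+w^2),\qquad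 w_y=-i\sqrt{\frac{1+\eta_1\mu^2}{1+\eta_2\mu^2}}\,\frac{v_x}{u}\,w+\frac{iv\mu}{2\sqrt{1+\eta_2\mu^2}}(1-w^2),$$ where the square roots are expanded in Taylor series at $\mu=0$. Equating the coefficients at the powers of $\mu$ gives expressions $\theta_{s,x}=P_s$, $\theta_{s,y}=Q_s$ $(s\ge0)$, in which $P_s$ and $Q_s$ are functions on $\mathcal E$ that depend also on $\theta_0,\dots,\theta_s$. For $l\ge0$ let $\mathcal E_l=\mathcal E\times\mathbb C^{l+1}$ with the complex fibre coordinates $\theta_0,\dots,\theta_l$, and let $$D_x^{[l]}=D_x+\sum_{s=0}^lP_s\frac{\partial}{\partial\theta_s},\qquad D_y^{[l]}=D_y+\sum_{s=0}^lQ_s\frac{\partial}{\partial\theta_s}.$$ Let $C^\infty(\mathcal E_l)$ be the set of complex-valued functions on $\mathcal E_l$ that depend on finitely many of the coordinates, are smooth in them, and are holomorphic in $\theta_0,\dots,\theta_l$. Then for every $l\ge0$ the solutions $f\in C^\infty(\mathcal E_l)$ of the system $$D_x^{[l]}(f)=0,\qquad D_y^{[l]}(f)=0$$ are exactly the constants.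 -/

import Mathlib

open scoped ContDiff

noncomputable section

namespace SDeformable

/-! ### The system `ℰ` in internal coordinates

The system expresses `u_yy` and `v_xx` through lower derivatives. Hence on its infinite prolongation
the derivatives `u_{x^i}`, `u_{x^i y}`, `v_{y^j}`, `v_{x y^j}` are independent and, together with
`x` and `y`, form a global coordinate system. -/

/-- Internal coordinates on `ℰ`: `u i = u_{x^i}`, `uy i = u_{x^i y}`, `v j = v_{y^j}`,
`vx j = v_{x y^j}`. -/
inductive Coord : Type
  | x : Coord
  | y : Coord
  | u : ℕ → Coord
  | uy : ℕ → Coord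
  | v : ℕ → Coord
  | vx : ℕ → Coord
  deriving DecidableEq

section TotalDerivatives

variable {F : Type*} [NormedAddCommGroup F] [NormedSpace ℝ F]

/-- The partial derivative `∂f/∂k` at `p`. -/
def pd (k : Coord) (f : (Coord → ℝ) → F) (p : Coord → ℝ) : F :=
  deriv (fun t : ℝ => f (Function.update p k t)) (p k)

/-- `∂_x + ∑ u_{x^{i+1}} ∂/∂u_{x^i} + ∑ u_{x^{i+1}y} ∂/∂u_{x^i y} + ∑ v_{xy^j} ∂/∂v_{y^j}
  + ∑ G_j ∂/∂v_{xy^j}`, where `G_j` stands for the expression of `v_{xxy^j}`. -/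
def dxWith (G : ℕ → (Coord → ℝ) → ℝ) (f : (Coord → ℝ) → F) (p : Coord → ℝ) : F :=
  pd .x f p + (∑ᶠ i, p (.u (i + 1)) • pd (.u i) f p) + (∑ᶠ i, p (.uy (i + 1)) • pd (.uy i) f p)
    + (∑ᶠ j, p (.vx j) • pd (.v j) f p) + (∑ᶠ j, G j p • pd (.vx j) f p)

/-- `∂_y + ∑ u_{x^i y} ∂/∂u_{x^i} + ∑ F_i ∂/∂u_{x^i y} + ∑ v_{y^{j+1}} ∂/∂v_{y^j}
  + ∑ v_{xy^{j+1}} ∂/∂v_{xy^j}`, where `F_i` stands for the expression of `u_{x^i yy}`. -/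
def dyWith (Φ : ℕ → (Coord → ℝ) → ℝ) (f : (Coord → ℝ) → F) (p : Coord → ℝ) : F :=
  pd .y f p + (∑ᶠ i, p (.uy i) • pd (.u i) f p) + (∑ᶠ i, Φ i p • pd (.uy i) f p)
    + (∑ᶠ j, p (.v (j + 1)) • pd (.v j) f p) + (∑ᶠ j, p (.vx (j + 1)) • pd (.vx j) f p)

end TotalDerivatives

/-- The right-hand side of the equation for `u_yy`. -/
def rhsU (η₁ η₂ : ℝ → ℝ) (p : Coord → ℝ) : ℝ :=
  (1 / 2 * deriv η₁ (p .x) * p (.v 0) ^ 2 * p (.vx 0)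
    + 1 / 2 * deriv η₂ (p .y) * p (.u 0) * p (.v 0) * p (.uy 0)
    + (η₁ (p .x) - η₂ (p .y)) * p (.u 0) * p (.uy 0) * p (.v 1)
    + p (.u 0) ^ 2 * p (.v 0) ^ 3)
  / (p (.u 0) * p (.v 0) * (η₁ (p .x) - η₂ (p .y)))

/-- The right-hand side of the equation for `v_xx`. -/
def rhsV (η₁ η₂ : ℝ → ℝ) (p : Coord → ℝ) : ℝ :=
  (1 / 2 * deriv η₁ (p .x) * p (.u 0) * p (.v 0) * p (.vx 0)
    + 1 / 2 * deriv η₂ (p .y) * p (.u 0) ^ 2 * p (.uy 0)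
    + (η₂ (p .y) - η₁ (p .x)) * p (.v 0) * p (.vx 0) * p (.u 1)
    + p (.u 0) ^ 3 * p (.v 0) ^ 2)
  / (p (.u 0) * p (.v 0) * (η₂ (p .y) - η₁ (p .x)))

/-- Stage `n` holds the expressions of `u_{x^i yy}` and of `v_{xxy^i}` for `i ≤ n` (and `0` in the
later places). The next stage adds `u_{x^{n+1}yy} = D_x u_{x^n yy}` and `v_{xxy^{n+1}} = D_y v_{xxy^n}`;
since `u_{x^n yy}` and `v_{xxy^n}` are expressed through coordinates of order at most `n + 1`, only
the entries already found take part in these derivatives. -/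
def stage (η₁ η₂ : ℝ → ℝ) : ℕ → (ℕ → (Coord → ℝ) → ℝ) × (ℕ → (Coord → ℝ) → ℝ)
  | 0 => (Function.update (fun _ _ => 0) 0 (rhsU η₁ η₂), Function.update (fun _ _ => 0) 0 (rhsV η₁ η₂))
  | n + 1 =>
    (Function.update (stage η₁ η₂ n).1 (n + 1)
        (dxWith (stage η₁ η₂ n).2 ((stage η₁ η₂ n).1 n)),
      Function.update (stage η₁ η₂ n).2 (n + 1)
        (dyWith (stage η₁ η₂ n).1 ((stage η₁ η₂ n).2 n)))

/-- `u_{x^i yy}` as a function on `ℰ`. -/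
def uyy (η₁ η₂ : ℝ → ℝ) (i : ℕ) : (Coord → ℝ) → ℝ := (stage η₁ η₂ i).1 i

/-- `v_{xxy^j}` as a function on `ℰ`. -/
def vxx (η₁ η₂ : ℝ → ℝ) (j : ℕ) : (Coord → ℝ) → ℝ := (stage η₁ η₂ j).2 j

/-- The total derivative `D_x` on `ℰ`. -/
def Dx {F : Type*} [NormedAddCommGroup F] [NormedSpace ℝ F] (η₁ η₂ : ℝ → ℝ)
    (f : (Coord → ℝ) → F) : (Coord → ℝ) → F :=
  dxWith (vxx η₁ η₂) f

/-- The total derivative `D_y` on `ℰ`. -/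
def Dy {F : Type*} [NormedAddCommGroup F] [NormedSpace ℝ F] (η₁ η₂ : ℝ → ℝ)
    (f : (Coord → ℝ) → F) : (Coord → ℝ) → F :=
  dyWith (uyy η₁ η₂) f

/-! #### The stages fit together: `D_x u_{x^i yy} = u_{x^{i+1}yy}`, `D_y v_{xxy^j} = v_{xxy^{j+1}}` -/

/-- The order of a coordinate. -/
def Coord.order : Coord → ℕ
  | .x => 0
  | .y => 0
  | .u i => i
  | .uy i => i + 1
  | .v j => j
  | .vx j => j + 1

/-- `f` depends on coordinates of order at most `n` only. -/
def OrderLE {F : Type*} (n : ℕ) (f : (Coord → ℝ) → F) : Prop :=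
  ∀ p q : Coord → ℝ, (∀ k, k.order ≤ n → p k = q k) → f p = f q

theorem OrderLE.mono {F : Type*} {m n : ℕ} {f : (Coord → ℝ) → F} (h : OrderLE m f) (hmn : m ≤ n) :
    OrderLE n f :=
  fun p q hpq => h p q fun k hk => hpq k (hk.trans hmn)

theorem OrderLE.pd_eq_zero {n : ℕ} {f : (Coord → ℝ) → ℝ} (h : OrderLE n f) {k : Coord}
    (hk : n < k.order) (p : Coord → ℝ) : pd k f p = 0 := by
  have : (fun t : ℝ => f (Function.update p k t)) = fun _ => f p := by
    funext t
    refine h _ _ fun k' hk' => ?_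
    rw [Function.update_of_ne]
    rintro rfl
    omega
  simp [pd, this]

theorem OrderLE.pd {n : ℕ} {f : (Coord → ℝ) → ℝ} (h : OrderLE n f) (k : Coord) :
    OrderLE n (pd k f) := by
  intro p q hpq
  by_cases hk : n < k.order
  · rw [h.pd_eq_zero hk, h.pd_eq_zero hk]
  · have : (fun t : ℝ => f (Function.update p k t)) = fun t => f (Function.update q k t) := by
      funext t
      refine h _ _ fun k' hk' => ?_
      by_cases e : k' = k
      · subst e; simp
      · simp [Function.update_of_ne e, hpq k' hk']
    simp only [SDeformable.pd]
    rw [this, hpq k (by omega)]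

theorem OrderLE.finsum_smul_pd {n : ℕ} {f : (Coord → ℝ) → ℝ} (h : OrderLE n f) (κ : ℕ → Coord)
    {a : ℕ → (Coord → ℝ) → ℝ} (ha : ∀ i, (κ i).order ≤ n → OrderLE (n + 1) (a i)) :
    OrderLE (n + 1) (fun p => ∑ᶠ i, a i p • SDeformable.pd (κ i) f p) := by
  intro p q hpq
  refine finsum_congr fun i => ?_
  by_cases hi : n < (κ i).order
  · rw [h.pd_eq_zero hi, h.pd_eq_zero hi, smul_zero, smul_zero]
  · rw [ha i (by omega) p q hpq, (h.pd (κ i)).mono (Nat.le_succ n) p q hpq]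

theorem orderLE_coord {n : ℕ} {k : Coord} (hk : k.order ≤ n) : OrderLE n (fun p => p k) :=
  fun _ _ h => h k hk

theorem OrderLE.dxWith {n : ℕ} {f : (Coord → ℝ) → ℝ} (h : OrderLE n f)
    {G : ℕ → (Coord → ℝ) → ℝ} (hG : ∀ j, j + 1 ≤ n → OrderLE (n + 1) (G j)) :
    OrderLE (n + 1) (dxWith G f) := by
  intro p q hpq
  have h1 := (h.pd .x).mono (Nat.le_succ n) p q hpq
  have h2 := h.finsum_smul_pd .u (a := fun i p => p (.u (i + 1)))
    (fun i hi => orderLE_coord (by simp [Coord.order] at hi ⊢; omega)) p q hpq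
  have h3 := h.finsum_smul_pd .uy (a := fun i p => p (.uy (i + 1)))
    (fun i hi => orderLE_coord (by simp [Coord.order] at hi ⊢; omega)) p q hpq
  have h4 := h.finsum_smul_pd .v (a := fun i p => p (.vx i))
    (fun i hi => orderLE_coord (by simp [Coord.order] at hi ⊢; omega)) p q hpq
  have h5 := h.finsum_smul_pd .vx (a := G) (fun i hi => hG i hi) p q hpq
  simp only [SDeformable.dxWith]
  simp only at h2 h3 h4 h5
  rw [h1, h2, h3, h4, h5]

theorem OrderLE.dyWith {n : ℕ} {f : (Coord → ℝ) → ℝ} (h : OrderLE n f)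
    {G : ℕ → (Coord → ℝ) → ℝ} (hG : ∀ j, j + 1 ≤ n → OrderLE (n + 1) (G j)) :
    OrderLE (n + 1) (dyWith G f) := by
  intro p q hpq
  have h1 := (h.pd .y).mono (Nat.le_succ n) p q hpq
  have h2 := h.finsum_smul_pd .u (a := fun i p => p (.uy i))
    (fun i hi => orderLE_coord (by simp [Coord.order] at hi ⊢; omega)) p q hpq
  have h3 := h.finsum_smul_pd .uy (a := G) (fun i hi => hG i hi) p q hpq
  have h4 := h.finsum_smul_pd .v (a := fun i p => p (.v (i + 1)))
    (fun i hi => orderLE_coord (by simp [Coord.order] at hi ⊢; omega)) p q hpq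
  have h5 := h.finsum_smul_pd .vx (a := fun i p => p (.vx (i + 1)))
    (fun i hi => orderLE_coord (by simp [Coord.order] at hi ⊢; omega)) p q hpq
  simp only [SDeformable.dyWith]
  simp only at h2 h3 h4 h5
  rw [h1, h2, h3, h4, h5]

theorem stage_eq (η₁ η₂ : ℝ → ℝ) (n : ℕ) : ∀ i ≤ n,
    (stage η₁ η₂ n).1 i = uyy η₁ η₂ i ∧ (stage η₁ η₂ n).2 i = vxx η₁ η₂ i := by
  induction n with
  | zero =>
    intro i hi
    obtain rfl : i = 0 := by omega
    exact ⟨rfl, rfl⟩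
  | succ n ih =>
    intro i hi
    rcases Nat.lt_or_ge n i with h | h
    · obtain rfl : i = n + 1 := by omega
      exact ⟨rfl, rfl⟩
    · have hne : i ≠ n + 1 := by omega
      have := ih i h
      simpa [stage, Function.update_of_ne hne] using this

theorem orderLE_uyy_vxx (η₁ η₂ : ℝ → ℝ) (n : ℕ) : ∀ i ≤ n,
    OrderLE (i + 1) (uyy η₁ η₂ i) ∧ OrderLE (i + 1) (vxx η₁ η₂ i) := by
  induction n with
  | zero =>
    intro i hi
    obtain rfl : i = 0 := by omega
    constructor <;> intro p q h
    · simp only [uyy, stage, Function.update_self, rhsU]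
      rw [h .x (by simp [Coord.order]), h .y (by simp [Coord.order]), h (.u 0) (by simp [Coord.order]),
        h (.v 0) (by simp [Coord.order]), h (.vx 0) (by simp [Coord.order]),
        h (.uy 0) (by simp [Coord.order]), h (.v 1) (by simp [Coord.order])]
    · simp only [vxx, stage, Function.update_self, rhsV]
      rw [h .x (by simp [Coord.order]), h .y (by simp [Coord.order]), h (.u 0) (by simp [Coord.order]),
        h (.v 0) (by simp [Coord.order]), h (.vx 0) (by simp [Coord.order]),
        h (.uy 0) (by simp [Coord.order]), h (.u 1) (by simp [Coord.order])]
  | succ n ih =>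
    intro i hi
    rcases Nat.lt_or_ge n i with h | h
    · obtain rfl : i = n + 1 := by omega
      constructor
      · simp only [uyy, stage, Function.update_self]
        refine OrderLE.dxWith ?_ fun j hj => ?_
        · rw [(stage_eq η₁ η₂ n n le_rfl).1]; exact (ih n le_rfl).1
        · rw [(stage_eq η₁ η₂ n j (by omega)).2]; exact (ih j (by omega)).2.mono (by omega)
      · simp only [vxx, stage, Function.update_self]
        refine OrderLE.dyWith ?_ fun j hj => ?_
        · rw [(stage_eq η₁ η₂ n n le_rfl).2]; exact (ih n le_rfl).2
        · rw [(stage_eq η₁ η₂ n j (by omega)).1]; exact (ih j (by omega)).1.mono (by omega)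
    · exact ih i h

theorem uyy_zero (η₁ η₂ : ℝ → ℝ) : uyy η₁ η₂ 0 = rhsU η₁ η₂ := by simp [uyy, stage]

theorem vxx_zero (η₁ η₂ : ℝ → ℝ) : vxx η₁ η₂ 0 = rhsV η₁ η₂ := by simp [vxx, stage]

theorem uyy_succ (η₁ η₂ : ℝ → ℝ) (i : ℕ) : uyy η₁ η₂ (i + 1) = Dx η₁ η₂ (uyy η₁ η₂ i) := by
  have h := (orderLE_uyy_vxx η₁ η₂ i i le_rfl).1
  conv_lhs => simp only [uyy, stage, Function.update_self]
  rw [(stage_eq η₁ η₂ i i le_rfl).1]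
  funext p
  simp only [Dx, dxWith]
  congr 1
  refine finsum_congr fun j => ?_
  by_cases hj : j ≤ i
  · rw [(stage_eq η₁ η₂ i j hj).2]
  · rw [h.pd_eq_zero (by simp [Coord.order]; omega), smul_zero, smul_zero]

theorem vxx_succ (η₁ η₂ : ℝ → ℝ) (j : ℕ) : vxx η₁ η₂ (j + 1) = Dy η₁ η₂ (vxx η₁ η₂ j) := by
  have h := (orderLE_uyy_vxx η₁ η₂ j j le_rfl).2
  conv_lhs => simp only [vxx, stage, Function.update_self]
  rw [(stage_eq η₁ η₂ j j le_rfl).2]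
  funext p
  simp only [Dy, dyWith]
  congr 3
  refine finsum_congr fun i => ?_
  by_cases hi : i ≤ j
  · rw [(stage_eq η₁ η₂ j i hi).1]
  · rw [h.pd_eq_zero (by simp [Coord.order]; omega), smul_zero, smul_zero]

/-! ### The tower of coverings `ℰ_l` -/

/-- The formal Taylor series at `μ = 0` of a real function of `μ`. -/
def taylorSeries (φ : ℝ → ℝ) : PowerSeries ℂ :=
  PowerSeries.mk fun n => ((iteratedDeriv n φ 0 / (Nat.factorial n : ℝ) : ℝ) : ℂ)

/-- The expansion of `1 / √(1 + c μ²)`. -/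
def invSqrtSeries (c : ℝ) : PowerSeries ℂ :=
  taylorSeries fun μ => 1 / √(1 + c * μ ^ 2)

/-- The expansion of `√((1 + c μ²) / (1 + d μ²))`. -/
def sqrtRatioSeries (c d : ℝ) : PowerSeries ℂ :=
  taylorSeries fun μ => √((1 + c * μ ^ 2) / (1 + d * μ ^ 2))

/-- The series `w = w₀ + w₁ μ + w₂ μ² + ⋯` with `w₀ = e^{θ₀}` and `w_k = θ_k e^{θ₀}` for `k > 0`. -/
def wSeries (θ : ℕ → ℂ) : PowerSeries ℂ :=
  PowerSeries.mk fun k => if k = 0 then Complex.exp (θ 0) else θ k * Complex.exp (θ 0)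

/-- The right-hand side of the `x`-part of the Riccati covering,
`w_x = i √((1 + η₂ μ²)/(1 + η₁ μ²)) (u_y / v) w + u μ / (2 √(1 + η₁ μ²)) (1 + w²)`,
expanded in `μ`. -/
def riccatiX (η₁ η₂ : ℝ → ℝ) (p : Coord → ℝ) (θ : ℕ → ℂ) : PowerSeries ℂ :=
  PowerSeries.C (Complex.I * (p (.uy 0) / p (.v 0) : ℝ))
      * sqrtRatioSeries (η₂ (p .y)) (η₁ (p .x)) * wSeries θ
    + PowerSeries.C ((p (.u 0) / 2 : ℝ) : ℂ) * PowerSeries.X * invSqrtSeries (η₁ (p .x))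
      * (1 + wSeries θ ^ 2)

/-- The right-hand side of the `y`-part of the Riccati covering,
`w_y = -i √((1 + η₁ μ²)/(1 + η₂ μ²)) (v_x / u) w + i v μ / (2 √(1 + η₂ μ²)) (1 - w²)`,
expanded in `μ`. -/
def riccatiY (η₁ η₂ : ℝ → ℝ) (p : Coord → ℝ) (θ : ℕ → ℂ) : PowerSeries ℂ :=
  -(PowerSeries.C (Complex.I * (p (.vx 0) / p (.u 0) : ℝ))
      * sqrtRatioSeries (η₁ (p .x)) (η₂ (p .y)) * wSeries θ)
    + PowerSeries.C (Complex.I * (p (.v 0) / 2 : ℝ)) * PowerSeries.X * invSqrtSeries (η₂ (p .y))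
      * (1 - wSeries θ ^ 2)

/-- The passage from `(w₀', w₁', …)` to `(θ₀', θ₁', …)` under `w₀ = e^{θ₀}`, `w_k = θ_k e^{θ₀}`:
`θ₀' = e^{-θ₀} w₀'` and `θ_k' = e^{-θ₀} w_k' - θ_k θ₀'`. -/
def thetaDot (R : PowerSeries ℂ) (θ : ℕ → ℂ) (k : ℕ) : ℂ :=
  if k = 0 then Complex.exp (-θ 0) * PowerSeries.coeff 0 R
  else Complex.exp (-θ 0) * PowerSeries.coeff k R
    - θ k * (Complex.exp (-θ 0) * PowerSeries.coeff 0 R)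

/-- The variables `θ₀, …, θ_l` as a sequence; the first `l + 1` components of the tower do not
involve the later entries. -/
def extend {l : ℕ} (θ : Fin (l + 1) → ℂ) (k : ℕ) : ℂ :=
  if h : k < l + 1 then θ ⟨k, h⟩ else 0

/-- The partial derivative `∂f/∂θ_s`. -/
def pdθ {l : ℕ} (s : Fin (l + 1)) (f : (Fin (l + 1) → ℂ) → ℂ) (θ : Fin (l + 1) → ℂ) : ℂ :=
  deriv (fun z : ℂ => f (Function.update θ s z)) (θ s)

/-- The total derivative `D_x^{[l]} = D_x + ∑_{s ≤ l} θ_{s,x} ∂/∂θ_s` on `ℰ_l`. -/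
def DxL (η₁ η₂ : ℝ → ℝ) (l : ℕ) (f : (Coord → ℝ) → (Fin (l + 1) → ℂ) → ℂ)
    (p : Coord → ℝ) (θ : Fin (l + 1) → ℂ) : ℂ :=
  Dx η₁ η₂ (fun p' => f p' θ) p
    + ∑ s : Fin (l + 1), thetaDot (riccatiX η₁ η₂ p (extend θ)) (extend θ) s * pdθ s (f p) θ

/-- The total derivative `D_y^{[l]} = D_y + ∑_{s ≤ l} θ_{s,y} ∂/∂θ_s` on `ℰ_l`. -/
def DyL (η₁ η₂ : ℝ → ℝ) (l : ℕ) (f : (Coord → ℝ) → (Fin (l + 1) → ℂ) → ℂ)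
    (p : Coord → ℝ) (θ : Fin (l + 1) → ℂ) : ℂ :=
  Dy η₁ η₂ (fun p' => f p' θ) p
    + ∑ s : Fin (l + 1), thetaDot (riccatiY η₁ η₂ p (extend θ)) (extend θ) s * pdθ s (f p) θ

/-- The part of `ℰ` lying over a set `Ω` of values of `(x, y, u, v)`. The covering space `ℰ_l` over
it is its product with the space of all `θ : Fin (l + 1) → ℂ`. -/
def equationOver (Ω : Set (ℝ × ℝ × ℝ × ℝ)) : Set (Coord → ℝ) :=
  {p | (p .x, p .y, p (.u 0), p (.v 0)) ∈ Ω}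

/-- `f ∈ C^∞(ℰ_l)`: `f` depends on finitely many coordinates of `ℰ` and on `θ₀, …, θ_l`, is smooth in
all of them jointly, and is holomorphic in the complex variables `θ₀, …, θ_l`. -/
structure IsSmoothOn (Ω : Set (ℝ × ℝ × ℝ × ℝ)) (l : ℕ)
    (f : (Coord → ℝ) → (Fin (l + 1) → ℂ) → ℂ) : Prop where
  finite_order : ∃ K : Finset Coord,
    (∀ p ∈ equationOver Ω, ∀ q ∈ equationOver Ω, (∀ k ∈ K, p k = q k) → f p = f q) ∧
    ∀ p ∈ equationOver Ω, ∀ θ : Fin (l + 1) → ℂ,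
      ContDiffAt ℝ ∞
        (fun q : (K → ℝ) × (Fin (l + 1) → ℂ) => f (Function.updateFinset p K q.1) q.2)
        (K.restrict p, θ)
  holomorphic : ∀ p ∈ equationOver Ω, Differentiable ℂ (f p)

end SDeformable

end

open scoped ContDiff

noncomputable section

namespace SDeformable

/-! ### Coordinates on which the right-hand sides depend -/

section Dependence

variable {F : Type*} [NormedAddCommGroup F] [NormedSpace ℝ F]

/-! A solution `f` is stripped of its variables from the top down. It involves finitely many jet
coordinates. Each `v_{xxy^j}` involves only `u_{x^i}`, `u_{x^i y}` with `i ≤ 1` (`dependsOn_vxx`),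
so if `f` does not involve `u_{x^{n+1}}` and `n ≥ 1`, the equation `D_x f = 0` is affine in
`u_{x^{n+1}}` with coefficient `∂f/∂u_{x^n}`, which must vanish. The same works for `u_{x^n y}` and,
with `D_y`, for `v_{y^n}` and `v_{x y^n}`. At `n = 0` one removes `u_y` and `v_x` before `u` and
`v`. What remains is a function of `x`, `y` and `θ`, at least locally.

The equations still contain `u_y`, `u`, `v_x`, `v` as affine parameters of the covering. Varying
them shows that `f`, as a function of `θ`, is killed by the four Riccati fields `r w`, `r⁻¹ w`, `μ
s₁ (1 + w²)`, `μ s₂ (1 - w²)`, where `r = √((1 + η₂ μ²)/(1 + η₁ μ²))` and `s₁`, `s₂` are the inverse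
square roots. Functions killed by two fields are killed by their commutator, and commutators of
Riccati fields are Riccati fields (`riccatiField_commutator`). Now `r - r⁻¹ = μ² q` with `q(0) = η₂
- η₁ ≠ 0`. Bracketing repeatedly with `μ² q w` gives, up to signs, the fields `μ^{2m+1} q^m s₁ (1 +
(-1)^m w²)` and `μ^{2m+1} q^m s₂ (1 - (-1)^m w²)`; brackets of these with the original odd fields
give nonzero multiples of `μ^{2m+2} q^m s s' w`. A field divisible by `μ^s` moves only `θ_s` and
later coordinates, and in every degree `s` some field moves `θ_s` at the given point. Descending
induction on `s` gives `∂f/∂θ_s = 0` for all `s` (`fderiv_eq_zero_of_isRiccatiInvariant`).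

Then `D_x f = D_y f = 0` reduces to `∂f/∂x = ∂f/∂y = 0`, so `f` is constant over the connected set
`Ω`. -/

theorem pd_eq_zero_of_dependsOn {S : Set Coord} {f : (Coord → ℝ) → F} (h : DependsOn f S)
    {k : Coord} (hk : k ∉ S) (p : Coord → ℝ) : pd k f p = 0 := by
  have : (fun t : ℝ => f (Function.update p k t)) = fun _ => f p := by
    funext t
    refine h fun i hi => ?_
    rw [Function.update_of_ne]
    rintro rfl
    exact hk hi
  simp [pd, this]

theorem dependsOn_pd {S : Set Coord} {f : (Coord → ℝ) → F} (h : DependsOn f S) (k : Coord) :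
    DependsOn (pd k f) S := by
  intro p q hpq
  by_cases hk : k ∈ S
  · have : (fun t : ℝ => f (Function.update p k t)) = fun t => f (Function.update q k t) := by
      funext t
      refine h fun i hi => ?_
      by_cases e : i = k
      · subst e; simp
      · simp [Function.update_of_ne e, hpq i hi]
    simp only [pd]
    rw [this, hpq k hk]
  · rw [pd_eq_zero_of_dependsOn h hk, pd_eq_zero_of_dependsOn h hk]

theorem dependsOn_finsum_smul_pd {S T : Set Coord} {f : (Coord → ℝ) → F} (h : DependsOn f S)
    (hST : S ⊆ T) (κ : ℕ → Coord) {a : ℕ → (Coord → ℝ) → ℝ}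
    (ha : ∀ i, κ i ∈ S → DependsOn (a i) T) :
    DependsOn (fun p => ∑ᶠ i, a i p • pd (κ i) f p) T := by
  intro p q hpq
  refine finsum_congr fun i => ?_
  by_cases hi : κ i ∈ S
  · rw [ha i hi hpq, dependsOn_pd h (κ i) fun j hj => hpq j (hST hj)]
  · rw [pd_eq_zero_of_dependsOn h hi, pd_eq_zero_of_dependsOn h hi, smul_zero, smul_zero]

theorem dependsOn_coord {T : Set Coord} {k : Coord} (hk : k ∈ T) :
    DependsOn (fun p : Coord → ℝ => p k) T :=
  fun _ _ h => h k hk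

theorem dependsOn_dxWith {S T : Set Coord} {f : (Coord → ℝ) → F} (h : DependsOn f S)
    (hST : S ⊆ T) {G : ℕ → (Coord → ℝ) → ℝ} (hu : ∀ i, .u i ∈ S → .u (i + 1) ∈ T)
    (huy : ∀ i, .uy i ∈ S → .uy (i + 1) ∈ T) (hv : ∀ j, .v j ∈ S → .vx j ∈ T)
    (hvx : ∀ j, .vx j ∈ S → DependsOn (G j) T) : DependsOn (dxWith G f) T := by
  intro p q hpq
  have h1 := dependsOn_pd h .x fun j hj => hpq j (hST hj)
  have h2 := dependsOn_finsum_smul_pd h hST .u (a := fun i p => p (.u (i + 1)))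
    (fun i hi => dependsOn_coord (hu i hi)) hpq
  have h3 := dependsOn_finsum_smul_pd h hST .uy (a := fun i p => p (.uy (i + 1)))
    (fun i hi => dependsOn_coord (huy i hi)) hpq
  have h4 := dependsOn_finsum_smul_pd h hST .v (a := fun i p => p (.vx i))
    (fun i hi => dependsOn_coord (hv i hi)) hpq
  have h5 := dependsOn_finsum_smul_pd h hST .vx (a := G) hvx hpq
  simp only [dxWith]
  simp only at h2 h3 h4 h5
  rw [h1, h2, h3, h4, h5]

theorem dependsOn_dyWith {S T : Set Coord} {f : (Coord → ℝ) → F} (h : DependsOn f S)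
    (hST : S ⊆ T) {G : ℕ → (Coord → ℝ) → ℝ} (hu : ∀ i, .u i ∈ S → .uy i ∈ T)
    (huy : ∀ i, .uy i ∈ S → DependsOn (G i) T) (hv : ∀ j, .v j ∈ S → .v (j + 1) ∈ T)
    (hvx : ∀ j, .vx j ∈ S → .vx (j + 1) ∈ T) : DependsOn (dyWith G f) T := by
  intro p q hpq
  have h1 := dependsOn_pd h .y fun j hj => hpq j (hST hj)
  have h2 := dependsOn_finsum_smul_pd h hST .u (a := fun i p => p (.uy i))
    (fun i hi => dependsOn_coord (hu i hi)) hpq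
  have h3 := dependsOn_finsum_smul_pd h hST .uy (a := G) huy hpq
  have h4 := dependsOn_finsum_smul_pd h hST .v (a := fun i p => p (.v (i + 1)))
    (fun i hi => dependsOn_coord (hv i hi)) hpq
  have h5 := dependsOn_finsum_smul_pd h hST .vx (a := fun i p => p (.vx (i + 1)))
    (fun i hi => dependsOn_coord (hvx i hi)) hpq
  simp only [dyWith]
  simp only at h2 h3 h4 h5
  rw [h1, h2, h3, h4, h5]

end Dependence

theorem dependsOn_rhsU (η₁ η₂ : ℝ → ℝ) :
    DependsOn (rhsU η₁ η₂) {.x, .y, .u 0, .uy 0, .v 0, .v 1, .vx 0} := by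
  intro p q h
  simp only [rhsU]
  rw [h .x (by simp), h .y (by simp), h (.u 0) (by simp), h (.uy 0) (by simp), h (.v 0) (by simp),
    h (.v 1) (by simp), h (.vx 0) (by simp)]

theorem dependsOn_rhsV (η₁ η₂ : ℝ → ℝ) :
    DependsOn (rhsV η₁ η₂) {.x, .y, .u 0, .u 1, .uy 0, .v 0, .vx 0} := by
  intro p q h
  simp only [rhsV]
  rw [h .x (by simp), h .y (by simp), h (.u 0) (by simp), h (.uy 0) (by simp), h (.v 0) (by simp),
    h (.u 1) (by simp), h (.vx 0) (by simp)]

/-- The number of `x`-derivatives in a coordinate `u_{x^i}` or `u_{x^i y}`, and `0` elsewhere. -/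
def Coord.uIndex : Coord → ℕ
  | .u i => i
  | .uy i => i
  | _ => 0

/-- The number of `y`-derivatives in a coordinate `v_{y^j}` or `v_{x y^j}`, and `0` elsewhere. -/
def Coord.vIndex : Coord → ℕ
  | .v j => j
  | .vx j => j
  | _ => 0

/-- `u_yy` contains no `u_x`, so one `D_x` raises the `u`-index to at most 1. The variable `v_x` in
`u_yy` produces `v_xx`, which contains `u_x` but nothing higher. -/
theorem dependsOn_uyy_one (η₁ η₂ : ℝ → ℝ) :
    DependsOn (uyy η₁ η₂ 1) {k | k.uIndex ≤ 1} := by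
  rw [uyy_succ, uyy_zero]
  refine dependsOn_dxWith (dependsOn_rhsU η₁ η₂) ?_ ?_ ?_ ?_ ?_
  · rintro k (rfl | rfl | rfl | rfl | rfl | rfl | rfl) <;> simp [Coord.uIndex]
  · simp [Coord.uIndex]
  · simp [Coord.uIndex]
  · simp [Coord.uIndex]
  · intro j hj
    obtain rfl : j = 0 := by simpa using hj
    rw [vxx_zero]
    refine (dependsOn_rhsV η₁ η₂).mono ?_
    rintro k (rfl | rfl | rfl | rfl | rfl | rfl | rfl) <;> simp [Coord.uIndex]

theorem dependsOn_vxx_one (η₁ η₂ : ℝ → ℝ) :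
    DependsOn (vxx η₁ η₂ 1) {k | k.vIndex ≤ 1} := by
  rw [vxx_succ, vxx_zero]
  refine dependsOn_dyWith (dependsOn_rhsV η₁ η₂) ?_ ?_ ?_ ?_ ?_
  · rintro k (rfl | rfl | rfl | rfl | rfl | rfl | rfl) <;> simp [Coord.vIndex]
  · simp [Coord.vIndex]
  · intro j hj
    obtain rfl : j = 0 := by simpa using hj
    rw [uyy_zero]
    refine (dependsOn_rhsU η₁ η₂).mono ?_
    rintro k (rfl | rfl | rfl | rfl | rfl | rfl | rfl) <;> simp [Coord.vIndex]
  · simp [Coord.vIndex]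
  · simp [Coord.vIndex]

/-- `D_y` never raises the number of `x`-derivatives on `u`, except possibly by replacing `u_{x^i
y}` with `u_{x^i yy}`; for `i ≤ 1` the result still has `u`-index at most 1, so the bound propagates
in `j`. -/
theorem dependsOn_vxx (η₁ η₂ : ℝ → ℝ) (j : ℕ) :
    DependsOn (vxx η₁ η₂ j) {k | k.uIndex ≤ 1} := by
  induction j with
  | zero =>
    rw [vxx_zero]
    refine (dependsOn_rhsV η₁ η₂).mono ?_
    rintro k (rfl | rfl | rfl | rfl | rfl | rfl | rfl) <;> simp [Coord.uIndex]
  | succ j ih =>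
    rw [vxx_succ]
    refine dependsOn_dyWith ih subset_rfl (fun i hi => hi) (fun i hi => ?_) (fun i hi => hi)
      (fun i hi => hi)
    have hi' : i ≤ 1 := hi
    interval_cases i
    · rw [uyy_zero]
      refine (dependsOn_rhsU η₁ η₂).mono ?_
      rintro k (rfl | rfl | rfl | rfl | rfl | rfl | rfl) <;> simp [Coord.uIndex]
    · exact dependsOn_uyy_one η₁ η₂

theorem dependsOn_uyy (η₁ η₂ : ℝ → ℝ) (i : ℕ) :
    DependsOn (uyy η₁ η₂ i) {k | k.vIndex ≤ 1} := by
  induction i with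
  | zero =>
    rw [uyy_zero]
    refine (dependsOn_rhsU η₁ η₂).mono ?_
    rintro k (rfl | rfl | rfl | rfl | rfl | rfl | rfl) <;> simp [Coord.vIndex]
  | succ i ih =>
    rw [uyy_succ]
    refine dependsOn_dxWith ih subset_rfl (fun j hj => hj) (fun j hj => hj) (fun j hj => hj)
      (fun j hj => ?_)
    have hj' : j ≤ 1 := hj
    interval_cases j
    · rw [vxx_zero]
      refine (dependsOn_rhsV η₁ η₂).mono ?_
      rintro k (rfl | rfl | rfl | rfl | rfl | rfl | rfl) <;> simp [Coord.vIndex]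
    · exact dependsOn_vxx_one η₁ η₂

/-! ### Coefficientwise derivatives of power series -/

/-- Every coefficient of `F` has the corresponding coefficient of `F'` as derivative at `t`. -/
def HasCoeffDerivAt (F : ℝ → PowerSeries ℂ) (F' : PowerSeries ℂ) (t : ℝ) : Prop :=
  ∀ k, HasDerivAt (fun s => PowerSeries.coeff k (F s)) (PowerSeries.coeff k F') t

namespace HasCoeffDerivAt

variable {F G : ℝ → PowerSeries ℂ} {F' G' : PowerSeries ℂ} {t : ℝ}

theorem const (A : PowerSeries ℂ) (t : ℝ) : HasCoeffDerivAt (fun _ => A) 0 t := by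
  intro k
  simpa using hasDerivAt_const t _

theorem add (hF : HasCoeffDerivAt F F' t) (hG : HasCoeffDerivAt G G' t) :
    HasCoeffDerivAt (fun s => F s + G s) (F' + G') t := by
  intro k
  simpa using (hF k).fun_add (hG k)

theorem sub (hF : HasCoeffDerivAt F F' t) (hG : HasCoeffDerivAt G G' t) :
    HasCoeffDerivAt (fun s => F s - G s) (F' - G') t := by
  intro k
  simpa using (hF k).fun_sub (hG k)

theorem mul (hF : HasCoeffDerivAt F F' t) (hG : HasCoeffDerivAt G G' t) :
    HasCoeffDerivAt (fun s => F s * G s) (F' * G t + F t * G') t := by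
  intro k
  simp only [map_add, PowerSeries.coeff_mul, ← Finset.sum_add_distrib]
  exact HasDerivAt.fun_sum fun ij _ => (hF ij.1).fun_mul (hG ij.2)

theorem C {c : ℝ → ℂ} {c' : ℂ} (hc : HasDerivAt c c' t) :
    HasCoeffDerivAt (fun s => PowerSeries.C (c s)) (PowerSeries.C c') t := by
  intro k
  by_cases hk : k = 0
  · simpa [PowerSeries.coeff_C, hk] using hc
  · simpa [PowerSeries.coeff_C, hk] using hasDerivAt_const t (0 : ℂ)

theorem constantCoeff (hF : HasCoeffDerivAt F F' t) :
    HasCoeffDerivAt (fun s => PowerSeries.C (PowerSeries.constantCoeff (F s)))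
      (PowerSeries.C (PowerSeries.constantCoeff F')) t := by
  refine HasCoeffDerivAt.C ?_
  simpa using hF 0

end HasCoeffDerivAt

/-! ### The Riccati vector fields on the fibres -/

theorem thetaDot_add (R S : PowerSeries ℂ) (θ : ℕ → ℂ) (k : ℕ) :
    thetaDot (R + S) θ k = thetaDot R θ k + thetaDot S θ k := by
  unfold thetaDot
  split_ifs <;> simp <;> ring

theorem thetaDot_C_mul (c : ℂ) (R : PowerSeries ℂ) (θ : ℕ → ℂ) (k : ℕ) :
    thetaDot (PowerSeries.C c * R) θ k = c * thetaDot R θ k := by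
  unfold thetaDot
  split_ifs <;> simp only [PowerSeries.coeff_C_mul] <;> ring

/-- Together with the next lemma this is the triangularity behind the descending induction: for `s >
0` a factor `μ^s` also kills the correction `θ_k θ₀'`, so `θ_s` is the first coordinate that can
move. -/
theorem thetaDot_X_pow_mul_of_lt (T : PowerSeries ℂ) (θ : ℕ → ℂ) {s k : ℕ} (hk : k < s) :
    thetaDot (PowerSeries.X ^ s * T) θ k = 0 := by
  have hs : s ≠ 0 := by omega
  have h0 : PowerSeries.coeff 0 (PowerSeries.X ^ s * T) = 0 := by simp [hs]
  simp only [thetaDot, h0, PowerSeries.coeff_X_pow_mul', if_neg (not_le.mpr hk)]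
  simp

theorem thetaDot_X_pow_mul_self (T : PowerSeries ℂ) (θ : ℕ → ℂ) (s : ℕ) :
    thetaDot (PowerSeries.X ^ s * T) θ s = Complex.exp (-θ 0) * PowerSeries.constantCoeff T := by
  rcases Nat.eq_zero_or_pos s with rfl | hs
  · simp [thetaDot]
  · have h0 : PowerSeries.coeff 0 (PowerSeries.X ^ s * T) = 0 := by simp [hs.ne']
    simp only [thetaDot, h0, PowerSeries.coeff_X_pow_mul', if_neg hs.ne']
    simp

/-- The series `1 + θ₁ μ + θ₂ μ² + ⋯`. -/
def omegaSeries (θ : ℕ → ℂ) : PowerSeries ℂ :=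
  PowerSeries.mk fun k => if k = 0 then 1 else θ k

/-- The series `θ₁ μ + θ₂ μ² + ⋯`. -/
def tailSeries (θ : ℕ → ℂ) : PowerSeries ℂ :=
  PowerSeries.mk fun k => if k = 0 then 0 else θ k

theorem wSeries_eq (θ : ℕ → ℂ) :
    wSeries θ = PowerSeries.C (Complex.exp (θ 0)) * omegaSeries θ := by
  ext k
  by_cases hk : k = 0
  · subst hk; simp [wSeries, omegaSeries]
  · simp [wSeries, omegaSeries, hk, mul_comm]

/-- With `ω = e^{-θ₀} w` and `ρ = e^{-θ₀} R`, both cases of `thetaDot` are coefficients of the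
single series `ρ - ρ(0) (ω - 1)`. This makes coefficientwise differentiation and ring identities
available. -/
theorem thetaDot_eq_coeff (R : PowerSeries ℂ) (θ : ℕ → ℂ) (k : ℕ) :
    thetaDot R θ k = PowerSeries.coeff k (PowerSeries.C (Complex.exp (-θ 0)) * R
      - PowerSeries.C (PowerSeries.constantCoeff (PowerSeries.C (Complex.exp (-θ 0)) * R))
        * (omegaSeries θ - 1)) := by
  by_cases hk : k = 0
  · subst hk; simp [thetaDot, omegaSeries]
  · rw [map_sub, PowerSeries.coeff_C_mul, PowerSeries.coeff_C_mul, map_sub, PowerSeries.coeff_one]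
    simp [thetaDot, omegaSeries, hk]
    ring

/-- `e^{-θ₀} (a + b w + c w²)`. -/
def riccatiReduced (a b c : PowerSeries ℂ) (θ : ℕ → ℂ) : PowerSeries ℂ :=
  a * PowerSeries.C (Complex.exp (-θ 0)) + b * omegaSeries θ
    + c * PowerSeries.C (Complex.exp (θ 0)) * (omegaSeries θ * omegaSeries θ)

theorem C_exp_neg_mul_riccati (a b c : PowerSeries ℂ) (θ : ℕ → ℂ) :
    PowerSeries.C (Complex.exp (-θ 0)) * (a + b * wSeries θ + c * wSeries θ ^ 2)
      = riccatiReduced a b c θ := by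
  have h : PowerSeries.C (Complex.exp (-θ 0)) * PowerSeries.C (Complex.exp (θ 0)) = 1 := by
    rw [← map_mul, ← Complex.exp_add]; simp
  rw [wSeries_eq, riccatiReduced]
  linear_combination (b * omegaSeries θ + c * PowerSeries.C (Complex.exp (θ 0)) *
    omegaSeries θ ^ 2) * h

/-- The vector field on the space of `θ₀, …, θ_l` induced by `w' = a + b w + c w²`. -/
def riccatiField {l : ℕ} (a b c : PowerSeries ℂ) (θ : Fin (l + 1) → ℂ) : Fin (l + 1) → ℂ :=
  fun s => thetaDot (a + b * wSeries (extend θ) + c * wSeries (extend θ) ^ 2) (extend θ) s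

theorem riccatiField_apply {l : ℕ} (a b c : PowerSeries ℂ) (θ : Fin (l + 1) → ℂ)
    (s : Fin (l + 1)) :
    riccatiField a b c θ s = PowerSeries.coeff s (riccatiReduced a b c (extend θ)
      - PowerSeries.C (PowerSeries.constantCoeff (riccatiReduced a b c (extend θ)))
        * (omegaSeries (extend θ) - 1)) := by
  rw [riccatiField, thetaDot_eq_coeff, C_exp_neg_mul_riccati]

/-- The derivative of `riccatiReduced a b c` along `v`. -/
def riccatiReducedDeriv (a b c : PowerSeries ℂ) (θ v : ℕ → ℂ) : PowerSeries ℂ :=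
  -(a * PowerSeries.C (Complex.exp (-θ 0)) * PowerSeries.C (v 0)) + b * tailSeries v
    + c * PowerSeries.C (Complex.exp (θ 0)) * (PowerSeries.C (v 0) *
      (omegaSeries θ * omegaSeries θ) + 2 * omegaSeries θ * tailSeries v)

theorem extend_add_smul {l : ℕ} (θ v : Fin (l + 1) → ℂ) (t : ℝ) (k : ℕ) :
    extend (θ + t • v) k = extend θ k + t • extend v k := by
  unfold extend
  split_ifs <;> simp

theorem hasDerivAt_extend {l : ℕ} (θ v : Fin (l + 1) → ℂ) (k : ℕ) (t : ℝ) :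
    HasDerivAt (fun t : ℝ => extend (θ + t • v) k) (extend v k) t := by
  simp only [extend_add_smul]
  simpa using ((hasDerivAt_id t).smul_const (extend v k)).const_add (extend θ k)

theorem hasCoeffDerivAt_omegaSeries {l : ℕ} (θ v : Fin (l + 1) → ℂ) (t : ℝ) :
    HasCoeffDerivAt (fun t : ℝ => omegaSeries (extend (θ + t • v))) (tailSeries (extend v)) t := by
  intro k
  by_cases hk : k = 0
  · simpa [omegaSeries, tailSeries, hk] using hasDerivAt_const t (1 : ℂ)
  · simpa [omegaSeries, tailSeries, hk] using hasDerivAt_extend θ v k t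

theorem hasCoeffDerivAt_riccatiReduced {l : ℕ} (a b c : PowerSeries ℂ) (θ v : Fin (l + 1) → ℂ) :
    HasCoeffDerivAt (fun t : ℝ => riccatiReduced a b c (extend (θ + t • v)))
      (riccatiReducedDeriv a b c (extend θ) (extend v)) 0 := by
  have hω := hasCoeffDerivAt_omegaSeries θ v 0
  have h0 := hasDerivAt_extend θ v 0 0
  have h1 := HasCoeffDerivAt.C h0.fun_neg.cexp
  have h2 := HasCoeffDerivAt.C h0.cexp
  have := (((HasCoeffDerivAt.const a 0).mul h1).add ((HasCoeffDerivAt.const b 0).mul hω)).add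
    (((HasCoeffDerivAt.const c 0).mul h2).mul (hω.mul hω))
  refine (congrArg (HasCoeffDerivAt _ · 0) ?_).mp this
  simp only [riccatiReducedDeriv, zero_smul, add_zero, map_mul, map_neg]
  ring

theorem hasDerivAt_riccatiField {l : ℕ} (a b c : PowerSeries ℂ) (θ v : Fin (l + 1) → ℂ) :
    HasDerivAt (fun t : ℝ => riccatiField a b c (θ + t • v))
      (fun s => PowerSeries.coeff s (riccatiReducedDeriv a b c (extend θ) (extend v)
        - PowerSeries.C (PowerSeries.constantCoeff
            (riccatiReducedDeriv a b c (extend θ) (extend v))) * (omegaSeries (extend θ) - 1)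
        - PowerSeries.C (PowerSeries.constantCoeff (riccatiReduced a b c (extend θ)))
          * tailSeries (extend v))) 0 := by
  rw [hasDerivAt_pi]
  intro s
  simp only [riccatiField_apply]
  have hρ := hasCoeffDerivAt_riccatiReduced a b c θ v
  have hω := hasCoeffDerivAt_omegaSeries θ v 0
  have := hρ.sub (hρ.constantCoeff.mul (hω.sub (HasCoeffDerivAt.const 1 0))) s
  refine (congrArg (HasDerivAt _ · 0) (congrArg _ ?_)).mp this
  simp only [zero_smul, add_zero, sub_zero]
  ring

/-- Along the field, `ω' = ρ - ρ(0) ω`. Since `extend` pads by zeros, this survives truncation only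
modulo `μ^{l+1}`; `Z` absorbs the error. -/
theorem tailSeries_riccatiField {l : ℕ} (a b c : PowerSeries ℂ) (θ : Fin (l + 1) → ℂ) :
    ∃ Z : PowerSeries ℂ, tailSeries (extend (riccatiField a b c θ))
      = riccatiReduced a b c (extend θ)
        - PowerSeries.C (PowerSeries.constantCoeff (riccatiReduced a b c (extend θ)))
          * omegaSeries (extend θ) + PowerSeries.X ^ (l + 1) * Z := by
  have : PowerSeries.X ^ (l + 1) ∣ tailSeries (extend (riccatiField a b c θ))
      - (riccatiReduced a b c (extend θ)
        - PowerSeries.C (PowerSeries.constantCoeff (riccatiReduced a b c (extend θ)))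
          * omegaSeries (extend θ)) := by
    rw [PowerSeries.X_pow_dvd_iff]
    intro k hk
    by_cases h0 : k = 0
    · subst h0; simp [tailSeries, omegaSeries]
    · have h1 : PowerSeries.coeff k (tailSeries (extend (riccatiField a b c θ)))
          = riccatiField a b c θ ⟨k, hk⟩ := by simp [tailSeries, h0, extend, Nat.lt_succ_iff.mp hk]
      rw [map_sub, h1, riccatiField_apply, map_sub, map_sub, PowerSeries.coeff_C_mul,
        PowerSeries.coeff_C_mul, map_sub, PowerSeries.coeff_one, if_neg h0]
      simp
  obtain ⟨Z, hZ⟩ := this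
  exact ⟨Z, by rw [← hZ]; ring⟩

theorem extend_riccatiField_zero {l : ℕ} (a b c : PowerSeries ℂ) (θ : Fin (l + 1) → ℂ) :
    extend (riccatiField a b c θ) 0
      = PowerSeries.constantCoeff (riccatiReduced a b c (extend θ)) := by
  simp [extend, riccatiField_apply, omegaSeries]

/-- The commutator of the vector fields induced by `a + b w + c w²` and `a' + b' w + c' w²`. -/
theorem riccatiField_commutator {l : ℕ} (a b c a' b' c' : PowerSeries ℂ) (θ : Fin (l + 1) → ℂ)
    (s : Fin (l + 1)) :
    PowerSeries.coeff s (riccatiReducedDeriv a' b' c' (extend θ) (extend (riccatiField a b c θ))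
        - PowerSeries.C (PowerSeries.constantCoeff
            (riccatiReducedDeriv a' b' c' (extend θ) (extend (riccatiField a b c θ))))
          * (omegaSeries (extend θ) - 1)
        - PowerSeries.C (PowerSeries.constantCoeff (riccatiReduced a' b' c' (extend θ)))
          * tailSeries (extend (riccatiField a b c θ)))
      - PowerSeries.coeff s
        (riccatiReducedDeriv a b c (extend θ) (extend (riccatiField a' b' c' θ))
        - PowerSeries.C (PowerSeries.constantCoeff
            (riccatiReducedDeriv a b c (extend θ) (extend (riccatiField a' b' c' θ))))
          * (omegaSeries (extend θ) - 1)
        - PowerSeries.C (PowerSeries.constantCoeff (riccatiReduced a b c (extend θ)))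
          * tailSeries (extend (riccatiField a' b' c' θ)))
      = riccatiField (a * b' - a' * b) (2 * (a * c' - a' * c)) (b * c' - b' * c) θ s := by
  obtain ⟨Z, hZ⟩ := tailSeries_riccatiField a b c θ
  obtain ⟨Z', hZ'⟩ := tailSeries_riccatiField a' b' c' θ
  have hE : PowerSeries.C (Complex.exp (-extend θ 0)) * PowerSeries.C (Complex.exp (extend θ 0))
      = 1 := by
    rw [← map_mul, ← Complex.exp_add]; simp
  have hω : PowerSeries.constantCoeff (omegaSeries (extend θ)) = 1 := by simp [omegaSeries]
  -- Chain rule: the second reduced Riccati series is differentiated along the first field, using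
  -- `θ₀' = ρ(0)` and `ω' = ρ - ρ(0) ω` up to the truncation error.
  have hD : ∀ {a b c a' b' c' Z : PowerSeries ℂ}, tailSeries (extend (riccatiField a b c θ))
      = riccatiReduced a b c (extend θ)
        - PowerSeries.C (PowerSeries.constantCoeff (riccatiReduced a b c (extend θ)))
          * omegaSeries (extend θ) + PowerSeries.X ^ (l + 1) * Z →
      riccatiReducedDeriv a' b' c' (extend θ) (extend (riccatiField a b c θ))
        = riccatiReduced a b c (extend θ) * (b' + 2 * c' * PowerSeries.C (Complex.exp (extend θ 0))
            * omegaSeries (extend θ))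
          - PowerSeries.C (PowerSeries.constantCoeff (riccatiReduced a b c (extend θ)))
            * riccatiReduced a' b' c' (extend θ)
          + PowerSeries.X ^ (l + 1) * (Z * (b' + 2 * c' *
            PowerSeries.C (Complex.exp (extend θ 0)) * omegaSeries (extend θ))) := by
    intro a b c a' b' c' Z h
    rw [riccatiReducedDeriv, h, extend_riccatiField_zero]
    simp only [riccatiReduced]
    ring
  -- The bracket of quadratic polynomials in `w`; the cubic terms cancel.
  have hN : riccatiReduced (a * b' - a' * b) (2 * (a * c' - a' * c)) (b * c' - b' * c) (extend θ)
      = riccatiReduced a b c (extend θ) * (b' + 2 * c' * PowerSeries.C (Complex.exp (extend θ 0))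
            * omegaSeries (extend θ))
        - riccatiReduced a' b' c' (extend θ) *
          (b + 2 * c * PowerSeries.C (Complex.exp (extend θ 0)) * omegaSeries (extend θ)) := by
    simp only [riccatiReduced]
    linear_combination (-2 * omegaSeries (extend θ) * (a * c' - a' * c)) * hE
  -- Only coefficients of index `s ≤ l` are compared, so truncation errors are harmless.
  have key : ∀ A B D : PowerSeries ℂ, A - D = PowerSeries.X ^ (l + 1) * B →
      PowerSeries.coeff (s : ℕ) A = PowerSeries.coeff (s : ℕ) D := by
    intro A B D h
    rw [← sub_eq_zero, ← map_sub, h, PowerSeries.coeff_X_pow_mul', if_neg (by omega)]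
  rw [riccatiField_apply, hN, hD hZ, hD hZ', hZ, hZ', ← map_sub]
  generalize riccatiReduced a b c (extend θ) = ρ
  generalize riccatiReduced a' b' c' (extend θ) = σ
  generalize omegaSeries (extend θ) = W at *
  simp only [map_add, map_sub, map_mul, map_pow, PowerSeries.constantCoeff_X,
    PowerSeries.constantCoeff_C, hω, zero_pow (Nat.succ_ne_zero l), zero_mul, mul_one,
    add_zero]
  simp only [← map_add, ← map_sub, ← map_mul]
  refine key _ (Z * (b' + 2 * c' * PowerSeries.C (Complex.exp (extend θ 0)) * W)
    - PowerSeries.C (PowerSeries.constantCoeff σ) * Z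
    - Z' * (b + 2 * c * PowerSeries.C (Complex.exp (extend θ 0)) * W)
    + PowerSeries.C (PowerSeries.constantCoeff ρ) * Z') _ ?_
  simp only [map_add, map_sub, map_mul]
  ring

/-! ### Functions on the fibres annihilated by Riccati vector fields -/

theorem riccatiField_add {l : ℕ} (a b c a' b' c' : PowerSeries ℂ) (θ : Fin (l + 1) → ℂ) :
    riccatiField (a + a') (b + b') (c + c') θ = riccatiField a b c θ + riccatiField a' b' c' θ := by
  funext s
  simp only [riccatiField, Pi.add_apply, ← thetaDot_add]
  congr 1
  ring

theorem riccatiField_C_mul {l : ℕ} (k : ℂ) (a b c : PowerSeries ℂ) (θ : Fin (l + 1) → ℂ) :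
    riccatiField (PowerSeries.C k * a) (PowerSeries.C k * b) (PowerSeries.C k * c) θ
      = k • riccatiField a b c θ := by
  funext s
  simp only [riccatiField, Pi.smul_apply, smul_eq_mul, ← thetaDot_C_mul]
  congr 1
  ring

/-- `g` is constant along the vector field induced by `w' = a + b w + c w²`. -/
def IsRiccatiInvariant {l : ℕ} (g : (Fin (l + 1) → ℂ) → ℂ) (a b c : PowerSeries ℂ) : Prop :=
  ∀ θ, fderiv ℂ g θ (riccatiField a b c θ) = 0

theorem map_piSingle_eq_mul {ι : Type*} [DecidableEq ι] (L : (ι → ℂ) →L[ℂ] ℂ) (k : ι) (c : ℂ) :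
    L (Pi.single k c) = c * L (Pi.single k 1) := by
  rw [← smul_eq_mul, ← map_smul, ← Pi.single_smul, smul_eq_mul, mul_one]

/-- If the derivatives of `g` along `X` and `Y` vanish, then so does the derivative along the
commutator. -/
theorem fderiv_commutator_eq_zero {E F : Type*} [NormedAddCommGroup E] [NormedSpace ℝ E]
    [NormedAddCommGroup F] [NormedSpace ℝ F] {g : E → F} (hg : ContDiff ℝ 2 g) {X Y : E → E}
    (hX : ∀ z, fderiv ℝ g z (X z) = 0) (hY : ∀ z, fderiv ℝ g z (Y z) = 0) {z X' Y' : E}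
    (hX' : HasDerivAt (fun t : ℝ => X (z + t • Y z)) X' 0)
    (hY' : HasDerivAt (fun t : ℝ => Y (z + t • X z)) Y' 0) :
    fderiv ℝ g z (Y' - X') = 0 := by
  have hd : Differentiable ℝ (fderiv ℝ g) :=
    (hg.fderiv_right (m := 1) (by norm_num)).differentiable (by norm_num)
  have hline : ∀ v : E, HasDerivAt (fun t : ℝ => fderiv ℝ g (z + t • v))
      (fderiv ℝ (fderiv ℝ g) z v) 0 := by
    intro v
    have h1 : HasDerivAt (fun t : ℝ => z + t • v) v 0 := by
      simpa using ((hasDerivAt_id (0 : ℝ)).smul_const v).const_add z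
    have h2 : HasFDerivAt (fderiv ℝ g) (fderiv ℝ (fderiv ℝ g) z) (z + (0 : ℝ) • v) := by
      simpa using (hd z).hasFDerivAt
    exact h2.comp_hasDerivAt (0 : ℝ) h1
  -- The identity `g'(V) = 0` is differentiated along `v`. Used for both fields, it leaves second
  -- derivatives that cancel by symmetry.
  have key : ∀ {V : E → E} {v V' : E}, (∀ z, fderiv ℝ g z (V z) = 0) →
      HasDerivAt (fun t : ℝ => V (z + t • v)) V' 0 →
      fderiv ℝ (fderiv ℝ g) z v (V z) + fderiv ℝ g z V' = 0 := by
    intro V v V' hV hV'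
    have h1 := (hline v).clm_apply hV'
    simp only [hV, zero_smul, add_zero] at h1
    exact h1.unique (hasDerivAt_const _ _)
  have hsymm : fderiv ℝ (fderiv ℝ g) z (X z) (Y z) = fderiv ℝ (fderiv ℝ g) z (Y z) (X z) :=
    (hg.contDiffAt.isSymmSndFDerivAt (by simp)) _ _
  have h1 := key hX hX'
  have h2 := key hY hY'
  rw [map_sub, eq_neg_of_add_eq_zero_right h1, eq_neg_of_add_eq_zero_right h2, hsymm, sub_self]

namespace IsRiccatiInvariant

variable {l : ℕ} {g : (Fin (l + 1) → ℂ) → ℂ} {a b c a' b' c' : PowerSeries ℂ}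

theorem add (h : IsRiccatiInvariant g a b c) (h' : IsRiccatiInvariant g a' b' c') :
    IsRiccatiInvariant g (a + a') (b + b') (c + c') := by
  intro θ
  rw [riccatiField_add, map_add, h, h', add_zero]

theorem C_mul (h : IsRiccatiInvariant g a b c) (k : ℂ) :
    IsRiccatiInvariant g (PowerSeries.C k * a) (PowerSeries.C k * b) (PowerSeries.C k * c) := by
  intro θ
  rw [riccatiField_C_mul, map_smul, h, smul_zero]

theorem neg (h : IsRiccatiInvariant g a b c) : IsRiccatiInvariant g (-a) (-b) (-c) := by
  simpa using h.C_mul (-1)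

theorem commutator (hg : Differentiable ℂ g) (hg2 : ContDiff ℝ 2 g)
    (h : IsRiccatiInvariant g a b c) (h' : IsRiccatiInvariant g a' b' c') :
    IsRiccatiInvariant g (a * b' - a' * b) (2 * (a * c' - a' * c)) (b * c' - b' * c) := by
  intro θ
  have hR : ∀ z v, fderiv ℝ g z v = fderiv ℂ g z v := fun z v => by
    rw [(hg z).fderiv_restrictScalars ℝ]; rfl
  have := fderiv_commutator_eq_zero hg2 (X := riccatiField a b c) (Y := riccatiField a' b' c')
    (fun z => (hR _ _).trans (h z)) (fun z => (hR _ _).trans (h' z))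
    (hasDerivAt_riccatiField a b c θ _) (hasDerivAt_riccatiField a' b' c' θ _)
  rw [hR] at this
  convert this using 2
  funext s
  exact (riccatiField_commutator a b c a' b' c' θ s).symm

/-- An invariant function does not depend on the leading coordinate of the vector field, once it
does not depend on the later coordinates. -/
theorem fderiv_single_eq_zero {A B D : PowerSeries ℂ} (s : Fin (l + 1))
    (h : IsRiccatiInvariant g (PowerSeries.X ^ (s : ℕ) * A) (PowerSeries.X ^ (s : ℕ) * B)
      (PowerSeries.X ^ (s : ℕ) * D)) {θ : Fin (l + 1) → ℂ}
    (hne : PowerSeries.constantCoeff (A + B * wSeries (extend θ) + D * wSeries (extend θ) ^ 2) ≠ 0)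
    (hlater : ∀ k, s < k → fderiv ℂ g θ (Pi.single k 1) = 0) :
    fderiv ℂ g θ (Pi.single s 1) = 0 := by
  have h1 := h θ
  rw [← Finset.univ_sum_single (riccatiField _ _ _ θ), map_sum,
    Finset.sum_eq_single s] at h1
  · rw [map_piSingle_eq_mul] at h1
    refine (mul_eq_zero.mp h1).resolve_left ?_
    rw [riccatiField, mul_assoc, mul_assoc, ← mul_add, ← mul_add, thetaDot_X_pow_mul_self]
    exact mul_ne_zero (Complex.exp_ne_zero _) hne
  · intro k _ hk
    rw [map_piSingle_eq_mul]
    rcases lt_or_gt_of_ne hk with hk | hk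
    · rw [riccatiField, mul_assoc, mul_assoc, ← mul_add, ← mul_add,
        thetaDot_X_pow_mul_of_lt _ _ hk, zero_mul]
    · rw [hlater k hk, mul_zero]
  · simp

end IsRiccatiInvariant

theorem constantCoeff_wSeries (θ : ℕ → ℂ) :
    PowerSeries.constantCoeff (wSeries θ) = Complex.exp (θ 0) := by
  simp [wSeries]

/-- A function on the fibre that is invariant under the vector fields of the Riccati covering is
constant. -/
theorem fderiv_eq_zero_of_isRiccatiInvariant {l : ℕ} {g : (Fin (l + 1) → ℂ) → ℂ}
    (hg : Differentiable ℂ g) (hg2 : ContDiff ℝ 2 g) {r r' s₁ s₂ q : PowerSeries ℂ}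
    (hr : PowerSeries.constantCoeff r = 1) (hq : r - r' = PowerSeries.X ^ 2 * q)
    (hq0 : PowerSeries.constantCoeff q ≠ 0)
    (hs₁ : PowerSeries.constantCoeff s₁ = 1) (hs₂ : PowerSeries.constantCoeff s₂ = 1)
    (h₁ : IsRiccatiInvariant g 0 r 0) (h₂ : IsRiccatiInvariant g 0 r' 0)
    (h₃ : IsRiccatiInvariant g (PowerSeries.X * s₁) 0 (PowerSeries.X * s₁))
    (h₄ : IsRiccatiInvariant g (PowerSeries.X * s₂) 0 (-(PowerSeries.X * s₂)))
    (θ : Fin (l + 1) → ℂ) : fderiv ℂ g θ = 0 := by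
  have hQ : IsRiccatiInvariant g 0 (PowerSeries.X ^ 2 * q) 0 := by
    rw [← hq]
    simpa [sub_eq_add_neg] using h₁.add h₂.neg
  -- The bracket with `μ² q w` scales the coefficients of `1` and `w²` by opposite signs, which
  -- produces the alternating `(-1)^m` below.
  have step : ∀ {A D : PowerSeries ℂ}, IsRiccatiInvariant g A 0 D →
      IsRiccatiInvariant g (PowerSeries.X ^ 2 * q * A) 0 (-(PowerSeries.X ^ 2 * q * D)) := by
    intro A D h
    have := (hQ.commutator hg hg2 h).neg
    simp only [zero_mul, mul_zero, sub_self, zero_sub, neg_neg, sub_zero, neg_zero] at this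
    rwa [mul_comm A] at this
  have hA : ∀ m : ℕ, IsRiccatiInvariant g (PowerSeries.X ^ (2 * m + 1) * (q ^ m * s₁)) 0
      (PowerSeries.X ^ (2 * m + 1) * ((-1) ^ m * q ^ m * s₁)) := by
    intro m
    induction m with
    | zero => simpa using h₃
    | succ m ih =>
      convert step ih using 1 <;> ring
  have hB : ∀ m : ℕ, IsRiccatiInvariant g (PowerSeries.X ^ (2 * m + 1) * (q ^ m * s₂)) 0
      (PowerSeries.X ^ (2 * m + 1) * ((-1) ^ (m + 1) * q ^ m * s₂)) := by
    intro m
    induction m with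
    | zero => simpa using h₄
    | succ m ih =>
      convert step ih using 1 <;> ring
  -- Descending induction on `s`, written as induction on a bound for `l + 1 - s`.
  have hsingle : ∀ n : ℕ, ∀ s : Fin (l + 1), l + 1 - (s : ℕ) ≤ n →
      fderiv ℂ g θ (Pi.single s 1) = 0 := by
    intro n
    induction n with
    | zero => intro s hs; have := s.2; omega
    | succ n ih =>
      intro s hs
      have hlater : ∀ k, s < k → fderiv ℂ g θ (Pi.single k 1) = 0 := by
        intro k hk
        refine ih k ?_
        have : (s : ℕ) < k := hk
        have := k.2
        omega
      set e := Complex.exp (extend θ 0) with he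
      have he0 : e ≠ 0 := Complex.exp_ne_zero _
      have h4 : PowerSeries.constantCoeff (4 : PowerSeries ℂ) = 4 := map_ofNat _ 4
      obtain ⟨m, hm | hm⟩ := Nat.even_or_odd' (s : ℕ)
      · rcases m with _ | m
        · have hs0 : (s : ℕ) = 0 := by simpa using hm
          refine IsRiccatiInvariant.fderiv_single_eq_zero (A := 0) (B := r) (D := 0) s ?_ ?_ hlater
          · simpa [hs0] using h₁
          · simp [hr, constantCoeff_wSeries]
        -- Degree `2m + 2`: the bracket has factor `-2(1 + (-1)^m)` with the field of `h₄` and `2(1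
        -- - (-1)^m)` with that of `h₃`. The parity of `m` selects the one that does not vanish.
        · rcases Nat.even_or_odd m with hme | hmo
          · refine IsRiccatiInvariant.fderiv_single_eq_zero (A := 0) (B := -4 * q ^ m * s₁ * s₂)
              (D := 0) s ?_ ?_ hlater
            · convert (hA m).commutator hg hg2 h₄ using 1
              · simp
              · rw [hm, hme.neg_one_pow]; ring
              · simp
            · simp [constantCoeff_wSeries, hs₁, hs₂, hq0, he0, h4, ← he]
          · refine IsRiccatiInvariant.fderiv_single_eq_zero (A := 0) (B := 4 * q ^ m * s₁ * s₁)
              (D := 0) s ?_ ?_ hlater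
            · convert (hA m).commutator hg hg2 h₃ using 1
              · simp
              · rw [hm, hmo.neg_one_pow]; ring
              · simp
            · simp [constantCoeff_wSeries, hs₁, hq0, he0, h4, ← he]
      -- Degree `2m + 1`: the leading coefficients are `q(0)^m (1 ± (-1)^m e^{2θ₀})`. They sum to `2
      -- q(0)^m ≠ 0`, so at each point one of the two fields moves `θ_s`.
      · by_cases h0 : 1 + (-1) ^ m * e ^ 2 = 0
        · have hB' := hB m
          rw [← hm] at hB'
          refine IsRiccatiInvariant.fderiv_single_eq_zero (B := 0) s (by simpa using hB') ?_ hlater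
          have : PowerSeries.constantCoeff (q ^ m * s₂ + 0 * wSeries (extend θ)
              + (-1) ^ (m + 1) * q ^ m * s₂ * wSeries (extend θ) ^ 2)
              = 2 * PowerSeries.constantCoeff q ^ m := by
            simp only [map_add, map_mul, map_pow, map_neg, map_one, map_zero,
              constantCoeff_wSeries, hs₂, ← he]
            linear_combination (-PowerSeries.constantCoeff q ^ m) * h0
          rw [this]
          exact mul_ne_zero two_ne_zero (pow_ne_zero _ hq0)
        · have hA' := hA m
          rw [← hm] at hA'
          refine IsRiccatiInvariant.fderiv_single_eq_zero (B := 0) s (by simpa using hA') ?_ hlater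
          have : PowerSeries.constantCoeff (q ^ m * s₁ + 0 * wSeries (extend θ)
              + (-1) ^ m * q ^ m * s₁ * wSeries (extend θ) ^ 2)
              = PowerSeries.constantCoeff q ^ m * (1 + (-1) ^ m * e ^ 2) := by
            simp only [map_add, map_mul, map_pow, map_neg, map_one, map_zero,
              constantCoeff_wSeries, hs₁, ← he]
            ring
          rw [this]
          exact mul_ne_zero (pow_ne_zero _ hq0) h0
  ext1 v
  rw [← Finset.univ_sum_single v, map_sum]
  refine Finset.sum_eq_zero fun s _ => ?_
  rw [map_piSingle_eq_mul, hsingle _ s le_rfl, mul_zero]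

/-! ### The first coefficients of the series -/

theorem constantCoeff_taylorSeries (φ : ℝ → ℝ) :
    PowerSeries.constantCoeff (taylorSeries φ) = φ 0 := by
  rw [← PowerSeries.coeff_zero_eq_constantCoeff_apply]
  simp [taylorSeries]

theorem constantCoeff_invSqrtSeries (c : ℝ) :
    PowerSeries.constantCoeff (invSqrtSeries c) = 1 := by
  simp [invSqrtSeries, constantCoeff_taylorSeries]

theorem constantCoeff_sqrtRatioSeries (c d : ℝ) :
    PowerSeries.constantCoeff (sqrtRatioSeries c d) = 1 := by
  simp [sqrtRatioSeries, constantCoeff_taylorSeries]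

theorem eventually_one_add_mul_sq_pos (c : ℝ) : ∀ᶠ μ in nhds (0 : ℝ), 0 < 1 + c * μ ^ 2 := by
  have h : ContinuousAt (fun μ : ℝ => 1 + c * μ ^ 2) 0 := by fun_prop
  exact h.eventually_const_lt (by simp)

theorem hasDerivAt_sqrtRatio {c d μ : ℝ} (hc : 0 < 1 + c * μ ^ 2) (hd : 0 < 1 + d * μ ^ 2) :
    HasDerivAt (fun μ : ℝ => √((1 + c * μ ^ 2) / (1 + d * μ ^ 2)))
      ((c - d) * μ / (√((1 + c * μ ^ 2) / (1 + d * μ ^ 2)) * (1 + d * μ ^ 2) ^ 2)) μ := by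
  have h : ∀ k : ℝ, HasDerivAt (fun μ : ℝ => 1 + k * μ ^ 2) (k * (2 * μ)) μ := fun k => by
    simpa using ((hasDerivAt_pow 2 μ).const_mul k).const_add 1
  have hs := Real.sqrt_pos.mpr (div_pos hc hd)
  convert ((h c).fun_div (h d) hd.ne').sqrt (div_pos hc hd).ne' using 1
  field_simp
  ring

theorem coeff_one_sqrtRatioSeries (c d : ℝ) :
    PowerSeries.coeff 1 (sqrtRatioSeries c d) = 0 := by
  have h := hasDerivAt_sqrtRatio (c := c) (d := d) (μ := 0) (by simp) (by simp)
  simp [sqrtRatioSeries, taylorSeries, iteratedDeriv_one, h.deriv]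

theorem coeff_two_sqrtRatioSeries (c d : ℝ) :
    PowerSeries.coeff 2 (sqrtRatioSeries c d) = ((c - d) / 2 : ℝ) := by
  -- Near `0` both radicands are positive, so the first derivative has a closed form with a factor
  -- `μ`. The second derivative at `0` is then `c - d`.
  have h1 : deriv (fun μ : ℝ => √((1 + c * μ ^ 2) / (1 + d * μ ^ 2))) =ᶠ[nhds 0] fun μ =>
      (c - d) * μ / (√((1 + c * μ ^ 2) / (1 + d * μ ^ 2)) * (1 + d * μ ^ 2) ^ 2) := by
    filter_upwards [eventually_one_add_mul_sq_pos c, eventually_one_add_mul_sq_pos d] with μ h h'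
    exact (hasDerivAt_sqrtRatio h h').deriv
  have h2 : HasDerivAt (fun μ : ℝ =>
      (c - d) * μ / (√((1 + c * μ ^ 2) / (1 + d * μ ^ 2)) * (1 + d * μ ^ 2) ^ 2)) (c - d) 0 := by
    have hd : HasDerivAt (fun μ : ℝ => (1 + d * μ ^ 2) ^ 2) 0 0 := by
      have := (((hasDerivAt_pow 2 (0 : ℝ)).const_mul d).const_add 1).fun_pow 2
      simpa using this
    have hs := (hasDerivAt_sqrtRatio (c := c) (d := d) (μ := 0) (by simp) (by simp)).fun_mul hd
    have := ((hasDerivAt_id (0 : ℝ)).const_mul (c - d)).fun_div hs (by simp)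
    simpa using this
  have h3 : iteratedDeriv 2 (fun μ : ℝ => √((1 + c * μ ^ 2) / (1 + d * μ ^ 2))) 0 = c - d := by
    rw [iteratedDeriv_succ, iteratedDeriv_one, h1.deriv_eq, h2.deriv]
  simp only [sqrtRatioSeries, taylorSeries, PowerSeries.coeff_mk, h3]
  norm_num [Nat.factorial]

theorem sqrtRatioSeries_sub (c d : ℝ) : ∃ q : PowerSeries ℂ,
    sqrtRatioSeries c d - sqrtRatioSeries d c = PowerSeries.X ^ 2 * q ∧
      PowerSeries.constantCoeff q = ((c - d : ℝ) : ℂ) := by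
  have h : PowerSeries.X ^ 2 ∣ sqrtRatioSeries c d - sqrtRatioSeries d c := by
    rw [PowerSeries.X_pow_dvd_iff]
    intro m hm
    interval_cases m
    · simp [constantCoeff_sqrtRatioSeries]
    · simp [coeff_one_sqrtRatioSeries]
  obtain ⟨q, hq⟩ := h
  refine ⟨q, hq, ?_⟩
  have := congrArg (PowerSeries.coeff 2) hq
  rw [map_sub, coeff_two_sqrtRatioSeries, coeff_two_sqrtRatioSeries,
    PowerSeries.coeff_X_pow_mul'] at this
  simp only [le_refl, if_true, Nat.sub_self, PowerSeries.coeff_zero_eq_constantCoeff] at this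
  rw [← this]
  push_cast
  ring

/-! ### Smooth functions on the coverings -/

/-- The coordinates `x, y, u, v` that are restricted by the domain. -/
def baseCoords : Set Coord := {.x, .y, .u 0, .v 0}

theorem mem_equationOver_congr {Ω : Set (ℝ × ℝ × ℝ × ℝ)} {p q : Coord → ℝ}
    (h : ∀ k ∈ baseCoords, p k = q k) (hp : p ∈ equationOver Ω) : q ∈ equationOver Ω := by
  simp only [equationOver, Set.mem_ofPred_eq] at hp ⊢
  rwa [← h .x (by simp [baseCoords]), ← h .y (by simp [baseCoords]),
    ← h (.u 0) (by simp [baseCoords]), ← h (.v 0) (by simp [baseCoords])]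

theorem update_mem_equationOver {Ω : Set (ℝ × ℝ × ℝ × ℝ)} {p : Coord → ℝ}
    (hp : p ∈ equationOver Ω) {k : Coord} (hk : k ∉ baseCoords) (t : ℝ) :
    Function.update p k t ∈ equationOver Ω := by
  refine mem_equationOver_congr (fun i hi => ?_) hp
  rw [Function.update_of_ne]
  rintro rfl
  exact hk hi

theorem eventually_mem_equationOver {Ω : Set (ℝ × ℝ × ℝ × ℝ)} (hopen : IsOpen Ω) {V : Type*}
    [TopologicalSpace V] {γ : V → Coord → ℝ} {a : V}
    (hγ : ∀ k, ContinuousAt (fun v => γ v k) a) (ha : γ a ∈ equationOver Ω) :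
    ∀ᶠ v in nhds a, γ v ∈ equationOver Ω :=
  ((hγ .x).prodMk ((hγ .y).prodMk ((hγ (.u 0)).prodMk (hγ (.v 0))))).eventually_mem
    (hopen.mem_nhds ha)

theorem contDiffAt_update {V : Type*} [NormedAddCommGroup V] [NormedSpace ℝ V]
    {γ : V → Coord → ℝ} {τ : V → ℝ} {a : V} (hγ : ∀ i, ContDiffAt ℝ ∞ (fun v => γ v i) a)
    (hτ : ContDiffAt ℝ ∞ τ a) (k i : Coord) :
    ContDiffAt ℝ ∞ (fun v => Function.update (γ v) k (τ v) i) a := by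
  by_cases h : i = k
  · subst h; simpa using hτ
  · simpa [Function.update_of_ne h] using hγ i

section Smooth

variable {Ω : Set (ℝ × ℝ × ℝ × ℝ)} {l : ℕ} {f : (Coord → ℝ) → (Fin (l + 1) → ℂ) → ℂ}

/-- Smoothness is assumed with the coordinates outside `K` frozen, whereas `γ` may move them. Near
`a` both the moving and the frozen point lie over the open set `Ω`, where `f` sees only `K`. -/
theorem IsSmoothOn.contDiffAt_comp (hopen : IsOpen Ω) (hf : IsSmoothOn Ω l f) {V : Type*}
    [NormedAddCommGroup V] [NormedSpace ℝ V] {γ : V → Coord → ℝ} {τ : V → Fin (l + 1) → ℂ} {a : V}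
    (hγ : ∀ k, ContDiffAt ℝ ∞ (fun v => γ v k) a) (hτ : ContDiffAt ℝ ∞ τ a)
    (ha : γ a ∈ equationOver Ω) : ContDiffAt ℝ ∞ (fun v => f (γ v) (τ v)) a := by
  obtain ⟨K, hK, hsm⟩ := hf.finite_order
  have h1 : ContDiffAt ℝ ∞ (fun v => fun k : K => γ v k) a :=
    contDiffAt_pi.mpr fun k => hγ (k : Coord)
  have h2 := ContDiffAt.comp a (hsm _ ha (τ a)) (h1.prodMk hτ)
  refine h2.congr_of_eventuallyEq ?_
  have h3 := eventually_mem_equationOver hopen (fun k => (hγ k).continuousAt) ha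
  have h4 : ∀ᶠ v in nhds a, Function.updateFinset (γ a) K (K.restrict (γ v)) ∈ equationOver Ω := by
    refine eventually_mem_equationOver hopen (fun k => ?_) ?_
    · by_cases hk : k ∈ K
      · simpa [Function.updateFinset, hk] using (hγ k).continuousAt
      · simpa [Function.updateFinset, hk] using continuousAt_const
    · convert ha
      funext k
      by_cases hk : k ∈ K <;> simp [Function.updateFinset, hk]
  filter_upwards [h3, h4] with v h3 h4
  exact congrFun (hK _ h3 _ h4 fun k hk => by simp [Function.updateFinset, hk]) (τ v)

theorem IsSmoothOn.contDiff (hopen : IsOpen Ω) (hf : IsSmoothOn Ω l f) {p : Coord → ℝ}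
    (hp : p ∈ equationOver Ω) : ContDiff ℝ ∞ (f p) :=
  contDiff_iff_contDiffAt.mpr fun _ =>
    hf.contDiffAt_comp hopen (γ := fun _ => p) (fun _ => contDiffAt_const) contDiffAt_id hp

theorem IsSmoothOn.differentiableAt_update (hopen : IsOpen Ω) (hf : IsSmoothOn Ω l f)
    {p : Coord → ℝ} {k : Coord} {t : ℝ} (hp : Function.update p k t ∈ equationOver Ω)
    (θ : Fin (l + 1) → ℂ) :
    DifferentiableAt ℝ (fun s : ℝ => f (Function.update p k s) θ) t :=
  (hf.contDiffAt_comp hopen (γ := fun s => Function.update p k s) (τ := fun _ => θ)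
    (contDiffAt_update (γ := fun _ => p) (τ := fun s => s) (fun _ => contDiffAt_const)
      contDiffAt_id k) contDiffAt_const
    hp).differentiableAt (by simp)

theorem eventually_update_mem (hopen : IsOpen Ω) {p : Coord → ℝ} (hp : p ∈ equationOver Ω)
    (k : Coord) : ∀ᶠ s in nhds (p k), Function.update p k s ∈ equationOver Ω :=
  eventually_mem_equationOver hopen
    (fun i => (contDiffAt_update (γ := fun _ => p) (τ := fun s => s) (fun _ => contDiffAt_const)
      contDiffAt_id k i).continuousAt)
    (by simpa using hp)

/-- `f` does not depend on the coordinate `k` over `Ω`. -/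
def IndepOn (Ω : Set (ℝ × ℝ × ℝ × ℝ)) {α : Type*} (f : (Coord → ℝ) → α) (k : Coord) : Prop :=
  ∀ p ∈ equationOver Ω, ∀ t, Function.update p k t ∈ equationOver Ω →
    f (Function.update p k t) = f p

theorem IndepOn.pd_eq_zero (hopen : IsOpen Ω) {k : Coord} (h : IndepOn Ω f k) {p : Coord → ℝ}
    (hp : p ∈ equationOver Ω) (θ : Fin (l + 1) → ℂ) : pd k (fun q => f q θ) p = 0 := by
  have : (fun t : ℝ => f (Function.update p k t) θ) =ᶠ[nhds (p k)] fun _ => f p θ := by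
    filter_upwards [eventually_update_mem hopen hp k] with s hs
    rw [h p hp s hs]
  rw [pd, this.deriv_eq, deriv_const]

theorem IndepOn.pd_update (hopen : IsOpen Ω) {k : Coord} (h : IndepOn Ω f k)
    (hk : k ∉ baseCoords) {p : Coord → ℝ} (hp : p ∈ equationOver Ω) (t : ℝ) (i : Coord)
    (θ : Fin (l + 1) → ℂ) :
    pd i (fun q => f q θ) (Function.update p k t) = pd i (fun q => f q θ) p := by
  by_cases hi : i = k
  · subst hi
    rw [h.pd_eq_zero hopen hp, h.pd_eq_zero hopen (update_mem_equationOver hp hk t)]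
  · have : (fun s : ℝ => f (Function.update (Function.update p k t) i s) θ)
        =ᶠ[nhds (p i)] fun s => f (Function.update p i s) θ := by
      filter_upwards [eventually_update_mem hopen hp i] with s hs
      rw [Function.update_comm (Ne.symm hi), h _ hs t (update_mem_equationOver hs hk t)]
    rw [pd, Function.update_of_ne hi, this.deriv_eq, pd]

/-- For `k` outside the base coordinates the whole line in direction `k` stays over `Ω`, so a
vanishing derivative gives independence globally along it. -/
theorem IsSmoothOn.indepOn (hopen : IsOpen Ω) (hf : IsSmoothOn Ω l f) {k : Coord}
    (hk : k ∉ baseCoords)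
    (h : ∀ p ∈ equationOver Ω, ∀ θ, pd k (fun q => f q θ) p = 0) : IndepOn Ω f k := by
  intro p hp t _
  funext θ
  have hd : Differentiable ℝ (fun s : ℝ => f (Function.update p k s) θ) := fun s =>
    hf.differentiableAt_update hopen (update_mem_equationOver hp hk s) θ
  have := is_const_of_deriv_eq_zero hd (fun s => by
    simpa [pd] using h _ (update_mem_equationOver hp hk s) θ) t (p k)
  simpa using this

theorem indepOn_of_notMem {K : Finset Coord} {k : Coord} (hk : k ∉ K)
    (hK : ∀ p ∈ equationOver Ω, ∀ q ∈ equationOver Ω, (∀ i ∈ K, p i = q i) → f p = f q) :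
    IndepOn Ω f k := by
  intro p hp t ht
  refine hK _ ht _ hp fun i hi => ?_
  rw [Function.update_of_ne]
  rintro rfl
  exact hk hi

/-- Needed because `finsum` is additive only for finite supports, and is `0` by default otherwise.
-/
theorem IsSmoothOn.finite_support (hopen : IsOpen Ω) (hf : IsSmoothOn Ω l f) {κ : ℕ → Coord}
    (hκ : Function.Injective κ) {p : Coord → ℝ} (hp : p ∈ equationOver Ω) (θ : Fin (l + 1) → ℂ) :
    {i | pd (κ i) (fun q => f q θ) p ≠ 0}.Finite := by
  obtain ⟨K, hK, -⟩ := hf.finite_order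
  refine (K.finite_toSet.preimage hκ.injOn).subset fun i hi => ?_
  by_contra h
  exact hi ((indepOn_of_notMem h hK).pd_eq_zero hopen hp θ)

theorem finsum_smul_eq_add {F : Type*} [NormedAddCommGroup F] [NormedSpace ℝ F] {a b : ℕ → ℝ}
    {d : ℕ → F} (hd : {i | d i ≠ 0}.Finite) {n : ℕ} (hab : ∀ i ≠ n, a i = b i)
    (hn : a n = b n + 1) : ∑ᶠ i, a i • d i = ∑ᶠ i, b i • d i + d n := by
  have h1 : d n = ∑ᶠ i, (if i = n then (1 : ℝ) else 0) • d i := by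
    rw [finsum_eq_single _ n (fun i hi => by simp [hi])]
    simp
  rw [h1, ← finsum_add_distrib]
  · refine finsum_congr fun i => ?_
    by_cases hi : i = n
    · subst hi; rw [hn, if_pos rfl, add_smul]
    · rw [hab i hi, if_neg hi, zero_smul, add_zero]
  · exact hd.subset fun i hi h => hi (by simp [h])
  · exact hd.subset fun i hi h => hi (by simp [h])

end Smooth

/-! ### Solutions do not depend on derivatives -/

theorem dependsOn_update {α : Type*} {S : Set Coord} {h : (Coord → ℝ) → α} (hS : DependsOn h S)
    {k : Coord} (hk : k ∉ S) (p : Coord → ℝ) (t : ℝ) : h (Function.update p k t) = h p := by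
  refine hS fun i hi => ?_
  rw [Function.update_of_ne]
  rintro rfl
  exact hk hi

theorem dependsOn_riccatiX (η₁ η₂ : ℝ → ℝ) (θ : ℕ → ℂ) :
    DependsOn (fun p => riccatiX η₁ η₂ p θ) {.x, .y, .u 0, .v 0, .uy 0} := by
  intro p q h
  simp only [riccatiX]
  rw [h .x (by simp), h .y (by simp), h (.u 0) (by simp), h (.v 0) (by simp), h (.uy 0) (by simp)]

theorem dependsOn_riccatiY (η₁ η₂ : ℝ → ℝ) (θ : ℕ → ℂ) :
    DependsOn (fun p => riccatiY η₁ η₂ p θ) {.x, .y, .u 0, .v 0, .vx 0} := by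
  intro p q h
  simp only [riccatiY]
  rw [h .x (by simp), h .y (by simp), h (.u 0) (by simp), h (.v 0) (by simp), h (.vx 0) (by simp)]

section Solutions

variable {η₁ η₂ : ℝ → ℝ} {Ω : Set (ℝ × ℝ × ℝ × ℝ)} {l : ℕ}
  {f : (Coord → ℝ) → (Fin (l + 1) → ℂ) → ℂ}

/-- The equation at a point is subtracted from the equation with `u_{x^{n+1}}` increased by 1; all
terms agree except `u_{x^{n+1}} ∂f/∂u_{x^n}`. Each term of `hvx` is unaffected either because its
coefficient is, or because `f` does not involve `v_{x y^j}`. The three lemmas that follow use the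
same argument. -/
theorem pd_u_eq_zero (hopen : IsOpen Ω) (hf : IsSmoothOn Ω l f)
    (hsol : ∀ p ∈ equationOver Ω, ∀ θ, DxL η₁ η₂ l f p θ = 0) {n : ℕ}
    (hI : IndepOn Ω f (.u (n + 1)))
    (hvx : ∀ j, DependsOn (vxx η₁ η₂ j) {.u (n + 1)}ᶜ ∨ IndepOn Ω f (.vx j))
    {p : Coord → ℝ} (hp : p ∈ equationOver Ω) (θ : Fin (l + 1) → ℂ) :
    pd (.u n) (fun q => f q θ) p = 0 := by
  have hk : Coord.u (n + 1) ∉ baseCoords := by simp [baseCoords]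
  set p' := Function.update p (.u (n + 1)) (p (.u (n + 1)) + 1) with hp'
  have hpM : p' ∈ equationOver Ω := update_mem_equationOver hp hk _
  have hpd : ∀ i, pd i (fun q => f q θ) p' = pd i (fun q => f q θ) p :=
    fun i => hI.pd_update hopen hk hp _ i θ
  have h1 := hsol p' hpM θ
  have h2 := hsol p hp θ
  have hf' : f p' = f p := hI p hp _ hpM
  have hr : riccatiX η₁ η₂ p' (extend θ) = riccatiX η₁ η₂ p (extend θ) :=
    dependsOn_update (dependsOn_riccatiX η₁ η₂ (extend θ)) (by simp) p _
  have e1 : ∑ᶠ i, p' (.u (i + 1)) • pd (.u i) (fun q => f q θ) p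
      = ∑ᶠ i, p (.u (i + 1)) • pd (.u i) (fun q => f q θ) p + pd (.u n) (fun q => f q θ) p :=
    finsum_smul_eq_add (hf.finite_support hopen (fun _ _ h => by simpa using h) hp θ)
      (fun i hi => by simp [hp', hi]) (by simp [hp'])
  have e2 : ∀ j, vxx η₁ η₂ j p' • pd (.vx j) (fun q => f q θ) p
      = vxx η₁ η₂ j p • pd (.vx j) (fun q => f q θ) p := by
    intro j
    rcases hvx j with h | h
    · rw [hp', dependsOn_update h (by simp)]
    · rw [h.pd_eq_zero hopen hp, smul_zero, smul_zero]
  have e3 : ∀ i, p' (.uy i) = p (.uy i) := fun i => by simp [hp']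
  have e4 : ∀ i, p' (.vx i) = p (.vx i) := fun i => by simp [hp']
  simp only [DxL, Dx, dxWith, hpd, hf', hr, e1, e2, e3, e4] at h1 h2
  linear_combination h1 - h2

theorem pd_uy_eq_zero (hopen : IsOpen Ω) (hf : IsSmoothOn Ω l f)
    (hsol : ∀ p ∈ equationOver Ω, ∀ θ, DxL η₁ η₂ l f p θ = 0) {n : ℕ}
    (hI : IndepOn Ω f (.uy (n + 1)))
    (hvx : ∀ j, DependsOn (vxx η₁ η₂ j) {.uy (n + 1)}ᶜ ∨ IndepOn Ω f (.vx j))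
    {p : Coord → ℝ} (hp : p ∈ equationOver Ω) (θ : Fin (l + 1) → ℂ) :
    pd (.uy n) (fun q => f q θ) p = 0 := by
  have hk : Coord.uy (n + 1) ∉ baseCoords := by simp [baseCoords]
  set p' := Function.update p (.uy (n + 1)) (p (.uy (n + 1)) + 1) with hp'
  have hpM : p' ∈ equationOver Ω := update_mem_equationOver hp hk _
  have hpd : ∀ i, pd i (fun q => f q θ) p' = pd i (fun q => f q θ) p :=
    fun i => hI.pd_update hopen hk hp _ i θ
  have h1 := hsol p' hpM θ
  have h2 := hsol p hp θ
  have hf' : f p' = f p := hI p hp _ hpM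
  have hr : riccatiX η₁ η₂ p' (extend θ) = riccatiX η₁ η₂ p (extend θ) :=
    dependsOn_update (dependsOn_riccatiX η₁ η₂ (extend θ)) (by simp) p _
  have e1 : ∑ᶠ i, p' (.uy (i + 1)) • pd (.uy i) (fun q => f q θ) p
      = ∑ᶠ i, p (.uy (i + 1)) • pd (.uy i) (fun q => f q θ) p + pd (.uy n) (fun q => f q θ) p :=
    finsum_smul_eq_add (hf.finite_support hopen (fun _ _ h => by simpa using h) hp θ)
      (fun i hi => by simp [hp', hi]) (by simp [hp'])
  have e2 : ∀ j, vxx η₁ η₂ j p' • pd (.vx j) (fun q => f q θ) p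
      = vxx η₁ η₂ j p • pd (.vx j) (fun q => f q θ) p := by
    intro j
    rcases hvx j with h | h
    · rw [hp', dependsOn_update h (by simp)]
    · rw [h.pd_eq_zero hopen hp, smul_zero, smul_zero]
  have e3 : ∀ i, p' (.u i) = p (.u i) := fun i => by simp [hp']
  have e4 : ∀ i, p' (.vx i) = p (.vx i) := fun i => by simp [hp']
  simp only [DxL, Dx, dxWith, hpd, hf', hr, e1, e2, e3, e4] at h1 h2
  linear_combination h1 - h2

theorem pd_v_eq_zero (hopen : IsOpen Ω) (hf : IsSmoothOn Ω l f)
    (hsol : ∀ p ∈ equationOver Ω, ∀ θ, DyL η₁ η₂ l f p θ = 0) {n : ℕ}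
    (hI : IndepOn Ω f (.v (n + 1)))
    (huy : ∀ i, DependsOn (uyy η₁ η₂ i) {.v (n + 1)}ᶜ ∨ IndepOn Ω f (.uy i))
    {p : Coord → ℝ} (hp : p ∈ equationOver Ω) (θ : Fin (l + 1) → ℂ) :
    pd (.v n) (fun q => f q θ) p = 0 := by
  have hk : Coord.v (n + 1) ∉ baseCoords := by simp [baseCoords]
  set p' := Function.update p (.v (n + 1)) (p (.v (n + 1)) + 1) with hp'
  have hpM : p' ∈ equationOver Ω := update_mem_equationOver hp hk _
  have hpd : ∀ i, pd i (fun q => f q θ) p' = pd i (fun q => f q θ) p :=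
    fun i => hI.pd_update hopen hk hp _ i θ
  have h1 := hsol p' hpM θ
  have h2 := hsol p hp θ
  have hf' : f p' = f p := hI p hp _ hpM
  have hr : riccatiY η₁ η₂ p' (extend θ) = riccatiY η₁ η₂ p (extend θ) :=
    dependsOn_update (dependsOn_riccatiY η₁ η₂ (extend θ)) (by simp) p _
  have e1 : ∑ᶠ i, p' (.v (i + 1)) • pd (.v i) (fun q => f q θ) p
      = ∑ᶠ i, p (.v (i + 1)) • pd (.v i) (fun q => f q θ) p + pd (.v n) (fun q => f q θ) p :=
    finsum_smul_eq_add (hf.finite_support hopen (fun _ _ h => by simpa using h) hp θ)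
      (fun i hi => by simp [hp', hi]) (by simp [hp'])
  have e2 : ∀ j, uyy η₁ η₂ j p' • pd (.uy j) (fun q => f q θ) p
      = uyy η₁ η₂ j p • pd (.uy j) (fun q => f q θ) p := by
    intro j
    rcases huy j with h | h
    · rw [hp', dependsOn_update h (by simp)]
    · rw [h.pd_eq_zero hopen hp, smul_zero, smul_zero]
  have e3 : ∀ i, p' (.uy i) = p (.uy i) := fun i => by simp [hp']
  have e4 : ∀ i, p' (.vx i) = p (.vx i) := fun i => by simp [hp']
  simp only [DyL, Dy, dyWith, hpd, hf', hr, e1, e2, e3, e4] at h1 h2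
  linear_combination h1 - h2

theorem pd_vx_eq_zero (hopen : IsOpen Ω) (hf : IsSmoothOn Ω l f)
    (hsol : ∀ p ∈ equationOver Ω, ∀ θ, DyL η₁ η₂ l f p θ = 0) {n : ℕ}
    (hI : IndepOn Ω f (.vx (n + 1)))
    (huy : ∀ i, DependsOn (uyy η₁ η₂ i) {.vx (n + 1)}ᶜ ∨ IndepOn Ω f (.uy i))
    {p : Coord → ℝ} (hp : p ∈ equationOver Ω) (θ : Fin (l + 1) → ℂ) :
    pd (.vx n) (fun q => f q θ) p = 0 := by
  have hk : Coord.vx (n + 1) ∉ baseCoords := by simp [baseCoords]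
  set p' := Function.update p (.vx (n + 1)) (p (.vx (n + 1)) + 1) with hp'
  have hpM : p' ∈ equationOver Ω := update_mem_equationOver hp hk _
  have hpd : ∀ i, pd i (fun q => f q θ) p' = pd i (fun q => f q θ) p :=
    fun i => hI.pd_update hopen hk hp _ i θ
  have h1 := hsol p' hpM θ
  have h2 := hsol p hp θ
  have hf' : f p' = f p := hI p hp _ hpM
  have hr : riccatiY η₁ η₂ p' (extend θ) = riccatiY η₁ η₂ p (extend θ) :=
    dependsOn_update (dependsOn_riccatiY η₁ η₂ (extend θ)) (by simp) p _
  have e1 : ∑ᶠ i, p' (.vx (i + 1)) • pd (.vx i) (fun q => f q θ) p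
      = ∑ᶠ i, p (.vx (i + 1)) • pd (.vx i) (fun q => f q θ) p + pd (.vx n) (fun q => f q θ) p :=
    finsum_smul_eq_add (hf.finite_support hopen (fun _ _ h => by simpa using h) hp θ)
      (fun i hi => by simp [hp', hi]) (by simp [hp'])
  have e2 : ∀ j, uyy η₁ η₂ j p' • pd (.uy j) (fun q => f q θ) p
      = uyy η₁ η₂ j p • pd (.uy j) (fun q => f q θ) p := by
    intro j
    rcases huy j with h | h
    · rw [hp', dependsOn_update h (by simp)]
    · rw [h.pd_eq_zero hopen hp, smul_zero, smul_zero]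
  have e3 : ∀ i, p' (.uy i) = p (.uy i) := fun i => by simp [hp']
  have e4 : ∀ i, p' (.v i) = p (.v i) := fun i => by simp [hp']
  simp only [DyL, Dy, dyWith, hpd, hf', hr, e1, e2, e3, e4] at h1 h2
  linear_combination h1 - h2

theorem exists_bound (hf : IsSmoothOn Ω l f) : ∃ B, ∀ n, B ≤ n →
    IndepOn Ω f (.u n) ∧ IndepOn Ω f (.uy n) ∧ IndepOn Ω f (.v n) ∧ IndepOn Ω f (.vx n) := by
  obtain ⟨K, hK, -⟩ := hf.finite_order
  refine ⟨K.sup (fun k => k.uIndex + k.vIndex) + 1, fun n hn => ?_⟩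
  have key : ∀ k : Coord, k.uIndex + k.vIndex = n → IndepOn Ω f k := by
    intro k hk
    refine indepOn_of_notMem (fun h => ?_) hK
    have : k.uIndex + k.vIndex ≤ K.sup fun k => k.uIndex + k.vIndex :=
      Finset.le_sup (f := fun k : Coord => k.uIndex + k.vIndex) h
    omega
  exact ⟨key _ (by simp [Coord.uIndex, Coord.vIndex]), key _ (by simp [Coord.uIndex, Coord.vIndex]),
    key _ (by simp [Coord.uIndex, Coord.vIndex]), key _ (by simp [Coord.uIndex, Coord.vIndex])⟩

theorem indepOn_succ (hopen : IsOpen Ω) (hf : IsSmoothOn Ω l f)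
    (hx : ∀ p ∈ equationOver Ω, ∀ θ, DxL η₁ η₂ l f p θ = 0)
    (hy : ∀ p ∈ equationOver Ω, ∀ θ, DyL η₁ η₂ l f p θ = 0) (n : ℕ) :
    IndepOn Ω f (.u (n + 1)) ∧ IndepOn Ω f (.uy (n + 1)) ∧ IndepOn Ω f (.v (n + 1)) ∧
      IndepOn Ω f (.vx (n + 1)) := by
  obtain ⟨B, hB⟩ := exists_bound hf
  -- Descending induction from the order bound `B`. It stops at index 1, since `v_{xxy^j}` and
  -- `u_{x^i yy}` may involve index 1.
  suffices H : ∀ d n, B ≤ n + d → IndepOn Ω f (.u (n + 1)) ∧ IndepOn Ω f (.uy (n + 1)) ∧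
      IndepOn Ω f (.v (n + 1)) ∧ IndepOn Ω f (.vx (n + 1)) from H B n (by omega)
  intro d
  induction d with
  | zero => intro n hn; exact hB _ (by omega)
  | succ d ih =>
    intro n hn
    obtain ⟨h1, h2, h3, h4⟩ := ih (n + 1) (by omega)
    refine ⟨hf.indepOn hopen (by simp [baseCoords]) fun p hp θ =>
        pd_u_eq_zero hopen hf hx h1 (fun j => .inl ((dependsOn_vxx η₁ η₂ j).mono ?_)) hp θ,
      hf.indepOn hopen (by simp [baseCoords]) fun p hp θ =>
        pd_uy_eq_zero hopen hf hx h2 (fun j => .inl ((dependsOn_vxx η₁ η₂ j).mono ?_)) hp θ,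
      hf.indepOn hopen (by simp [baseCoords]) fun p hp θ =>
        pd_v_eq_zero hopen hf hy h3 (fun j => .inl ((dependsOn_uyy η₁ η₂ j).mono ?_)) hp θ,
      hf.indepOn hopen (by simp [baseCoords]) fun p hp θ =>
        pd_vx_eq_zero hopen hf hy h4 (fun j => .inl ((dependsOn_uyy η₁ η₂ j).mono ?_)) hp θ⟩ <;>
    · rintro k hk rfl
      simp [Coord.uIndex, Coord.vIndex] at hk

theorem indepOn_of_notMem_baseCoords (hopen : IsOpen Ω) (hf : IsSmoothOn Ω l f)
    (hx : ∀ p ∈ equationOver Ω, ∀ θ, DxL η₁ η₂ l f p θ = 0)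
    (hy : ∀ p ∈ equationOver Ω, ∀ θ, DyL η₁ η₂ l f p θ = 0) {k : Coord} (hk : k ∉ baseCoords) :
    IndepOn Ω f k := by
  have hs := indepOn_succ hopen hf hx hy
  match k with
  | .x => exact absurd (by simp [baseCoords]) hk
  | .y => exact absurd (by simp [baseCoords]) hk
  | .u 0 => exact absurd (by simp [baseCoords]) hk
  | .v 0 => exact absurd (by simp [baseCoords]) hk
  | .u (n + 1) => exact (hs n).1
  | .uy (n + 1) => exact (hs n).2.1
  | .v (n + 1) => exact (hs n).2.2.1
  | .vx (n + 1) => exact (hs n).2.2.2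
  | .uy 0 =>
    refine hf.indepOn hopen hk fun p hp θ => pd_uy_eq_zero hopen hf hx (hs 0).2.1 (fun j => ?_) hp θ
    -- `v_xx` is free of `u_xy`, and the later `v_{xxy^j}` multiply derivatives of `f` already known
    -- to vanish.
    match j with
    | 0 =>
      rw [vxx_zero]
      refine .inl ((dependsOn_rhsV η₁ η₂).mono ?_)
      rintro k (rfl | rfl | rfl | rfl | rfl | rfl | rfl) <;> simp
    | j + 1 => exact .inr (hs j).2.2.2
  | .vx 0 =>
    refine hf.indepOn hopen hk fun p hp θ =>
      pd_vx_eq_zero hopen hf hy (hs 0).2.2.2 (fun j => ?_) hp θ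
    match j with
    | 0 =>
      rw [uyy_zero]
      refine .inl ((dependsOn_rhsU η₁ η₂).mono ?_)
      rintro k (rfl | rfl | rfl | rfl | rfl | rfl | rfl) <;> simp
    | j + 1 => exact .inr (hs j).2.1

end Solutions

/-! ### The fibre directions -/

theorem sum_mul_pdθ {l : ℕ} {g : (Fin (l + 1) → ℂ) → ℂ} (hg : Differentiable ℂ g)
    (v θ : Fin (l + 1) → ℂ) : ∑ s, v s * pdθ s g θ = fderiv ℂ g θ v := by
  have h : ∀ s, pdθ s g θ = fderiv ℂ g θ (Pi.single s 1) := by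
    intro s
    have h1 : HasFDerivAt g (fderiv ℂ g θ) (Function.update θ s (θ s)) := by
      simpa using (hg θ).hasFDerivAt
    exact (h1.comp_hasDerivAt (θ s) (hasDerivAt_update θ s (θ s))).deriv
  conv_rhs => rw [← Finset.univ_sum_single v, map_sum]
  exact Finset.sum_congr rfl fun s _ => by
    rw [h, map_piSingle_eq_mul _ _ (v s)]

theorem map_riccatiField_eq_zero_of_shift {l : ℕ} {L : (Fin (l + 1) → ℂ) →L[ℂ] ℂ} {d k : ℂ}
    {A B D A' B' D' a b c : PowerSeries ℂ} {θ : Fin (l + 1) → ℂ} (hk : k ≠ 0)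
    (h : d + L (riccatiField A B D θ) = 0) (h' : d + L (riccatiField A' B' D' θ) = 0)
    (hA : A' = A + PowerSeries.C k * a) (hB : B' = B + PowerSeries.C k * b)
    (hD : D' = D + PowerSeries.C k * c) : L (riccatiField a b c θ) = 0 := by
  rw [hA, hB, hD, riccatiField_add, riccatiField_C_mul, map_add, map_smul, smul_eq_mul] at h'
  exact (mul_eq_zero.mp (by linear_combination h' - h)).resolve_left hk

theorem thetaDot_riccatiX {l : ℕ} (η₁ η₂ : ℝ → ℝ) (p : Coord → ℝ) (θ : Fin (l + 1) → ℂ) :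
    (fun s : Fin (l + 1) => thetaDot (riccatiX η₁ η₂ p (extend θ)) (extend θ) s)
      = riccatiField
        (PowerSeries.C ((p (.u 0) / 2 : ℝ) : ℂ) * (PowerSeries.X * invSqrtSeries (η₁ (p .x))))
        (PowerSeries.C (Complex.I * (p (.uy 0) / p (.v 0) : ℝ))
          * sqrtRatioSeries (η₂ (p .y)) (η₁ (p .x)))
        (PowerSeries.C ((p (.u 0) / 2 : ℝ) : ℂ) * (PowerSeries.X * invSqrtSeries (η₁ (p .x))))
        θ := by
  funext s
  rw [riccatiField, riccatiX]
  congr 1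
  ring

theorem thetaDot_riccatiY {l : ℕ} (η₁ η₂ : ℝ → ℝ) (p : Coord → ℝ) (θ : Fin (l + 1) → ℂ) :
    (fun s : Fin (l + 1) => thetaDot (riccatiY η₁ η₂ p (extend θ)) (extend θ) s)
      = riccatiField
        (PowerSeries.C (Complex.I * (p (.v 0) / 2 : ℝ))
          * (PowerSeries.X * invSqrtSeries (η₂ (p .y))))
        (PowerSeries.C (-(Complex.I * (p (.vx 0) / p (.u 0) : ℝ)))
          * sqrtRatioSeries (η₁ (p .x)) (η₂ (p .y)))
        (PowerSeries.C (Complex.I * (p (.v 0) / 2 : ℝ))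
          * -(PowerSeries.X * invSqrtSeries (η₂ (p .y)))) θ := by
  funext s
  rw [riccatiField, riccatiY, map_neg]
  congr 1
  ring

section Solutions

variable {η₁ η₂ : ℝ → ℝ} {Ω : Set (ℝ × ℝ × ℝ × ℝ)} {l : ℕ}
  {f : (Coord → ℝ) → (Fin (l + 1) → ℂ) → ℂ}

theorem DxL_eq_of_pd_eq_zero (hf : IsSmoothOn Ω l f) {p : Coord → ℝ} (hp : p ∈ equationOver Ω)
    {θ : Fin (l + 1) → ℂ}
    (hpd : ∀ k, k ≠ .x → k ≠ .y → pd k (fun q => f q θ) p = 0) :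
    DxL η₁ η₂ l f p θ = pd .x (fun q => f q θ) p + fderiv ℂ (f p) θ
      (fun s => thetaDot (riccatiX η₁ η₂ p (extend θ)) (extend θ) s) := by
  rw [DxL, sum_mul_pdθ (hf.holomorphic p hp)
    (fun s => thetaDot (riccatiX η₁ η₂ p (extend θ)) (extend θ) s)]
  simp [Dx, dxWith, hpd]

theorem DyL_eq_of_pd_eq_zero (hf : IsSmoothOn Ω l f) {p : Coord → ℝ} (hp : p ∈ equationOver Ω)
    {θ : Fin (l + 1) → ℂ}
    (hpd : ∀ k, k ≠ .x → k ≠ .y → pd k (fun q => f q θ) p = 0) :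
    DyL η₁ η₂ l f p θ = pd .y (fun q => f q θ) p + fderiv ℂ (f p) θ
      (fun s => thetaDot (riccatiY η₁ η₂ p (extend θ)) (extend θ) s) := by
  rw [DyL, sum_mul_pdθ (hf.holomorphic p hp)
    (fun s => thetaDot (riccatiY η₁ η₂ p (extend θ)) (extend θ) s)]
  simp [Dy, dyWith, hpd]

/-- If `∂f/∂c = 0`, then `c` can be changed slightly without changing `f`, simultaneously for all
nearby values of another coordinate `b`. -/
theorem exists_update_eq (hopen : IsOpen Ω) (hf : IsSmoothOn Ω l f) {b c : Coord} (hbc : b ≠ c)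
    (hc : ∀ p ∈ equationOver Ω, ∀ θ, pd c (fun q => f q θ) p = 0) {p : Coord → ℝ}
    (hp : p ∈ equationOver Ω) :
    ∃ t ≠ p c, Function.update p c t ∈ equationOver Ω ∧ f (Function.update p c t) = f p ∧
      ∀ θ, pd b (fun q => f q θ) (Function.update p c t) = pd b (fun q => f q θ) p := by
  -- The slices of `Ω` may be disconnected, so independence of `c` is only local. A product of
  -- intervals in `(b, c)` makes it uniform in `b`, as needed to compare `∂f/∂b` at the two points.
  have h1 : ∀ᶠ z : ℝ × ℝ in nhds (p b, p c),
      Function.update (Function.update p b z.1) c z.2 ∈ equationOver Ω := by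
    refine eventually_mem_equationOver hopen (fun i => ?_) (by simpa [hbc] using hp)
    exact (contDiffAt_update (contDiffAt_update (γ := fun _ => p) (fun _ => contDiffAt_const)
      contDiffAt_fst b) contDiffAt_snd c i).continuousAt
  obtain ⟨ε, hε, hball⟩ := Metric.eventually_nhds_iff_ball.mp h1
  have hM : ∀ s ∈ Metric.ball (p b) ε, ∀ t ∈ Metric.ball (p c) ε,
      Function.update (Function.update p b s) c t ∈ equationOver Ω := by
    intro s hs t ht
    refine hball (s, t) ?_
    rw [← ball_prod_same]
    exact ⟨hs, ht⟩
  have ht : p c + ε / 2 ∈ Metric.ball (p c) ε := by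
    rw [Metric.mem_ball, Real.dist_eq, add_sub_cancel_left, abs_of_pos (by positivity)]
    linarith
  have hconst : ∀ s ∈ Metric.ball (p b) ε,
      f (Function.update (Function.update p b s) c (p c + ε / 2)) = f (Function.update p b s) := by
    intro s hs
    funext θ
    have h := Metric.isOpen_ball.is_const_of_deriv_eq_zero
      (convex_ball (p c) ε).isPreconnected
      (f := fun t : ℝ => f (Function.update (Function.update p b s) c t) θ)
      (fun t ht => (hf.differentiableAt_update hopen (hM s hs t ht) θ).differentiableWithinAt)
      (fun t ht => by simpa [pd] using hc _ (hM s hs t ht) θ) ht (Metric.mem_ball_self hε)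
    have hcs : Function.update (Function.update p b s) c (p c) = Function.update p b s := by
      conv_lhs => rw [← Function.update_of_ne (Ne.symm hbc) s p]
      exact Function.update_eq_self _ _
    simpa only [hcs] using h
  have hpb := Metric.mem_ball_self (x := p b) hε
  have hmem := hM (p b) hpb _ ht
  have heq := hconst (p b) hpb
  rw [Function.update_eq_self] at hmem heq
  refine ⟨p c + ε / 2, by linarith, hmem, heq, fun θ => ?_⟩
  have : (fun s : ℝ => f (Function.update (Function.update p c (p c + ε / 2)) b s) θ)
      =ᶠ[nhds (p b)] fun s => f (Function.update p b s) θ := by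
    filter_upwards [Metric.ball_mem_nhds (p b) hε] with s hs
    rw [Function.update_comm (Ne.symm hbc), hconst s hs]
  rw [pd, Function.update_of_ne hbc, this.deriv_eq, pd]

/-- `v_xx` contains `u_x`, and `u_yy` contains `v_y`; this is harmless for `u` and `v` because
dependence on all `v_{x y^j}` and `u_{x^i y}` has already been excluded. -/
theorem pd_eq_zero_of_ne (hopen : IsOpen Ω) (hf : IsSmoothOn Ω l f)
    (hx : ∀ p ∈ equationOver Ω, ∀ θ, DxL η₁ η₂ l f p θ = 0)
    (hy : ∀ p ∈ equationOver Ω, ∀ θ, DyL η₁ η₂ l f p θ = 0) {k : Coord} (hkx : k ≠ .x)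
    (hky : k ≠ .y) {p : Coord → ℝ} (hp : p ∈ equationOver Ω) (θ : Fin (l + 1) → ℂ) :
    pd k (fun q => f q θ) p = 0 := by
  have hI : ∀ {k}, k ∉ baseCoords → IndepOn Ω f k :=
    fun hk => indepOn_of_notMem_baseCoords hopen hf hx hy hk
  by_cases hk : k ∈ baseCoords
  · rcases hk with rfl | rfl | rfl | rfl
    · exact absurd rfl hkx
    · exact absurd rfl hky
    · exact pd_u_eq_zero hopen hf hx (hI (by simp [baseCoords]))
        (fun j => .inr (hI (by simp [baseCoords]))) hp θ
    · exact pd_v_eq_zero hopen hf hy (hI (by simp [baseCoords]))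
        (fun j => .inr (hI (by simp [baseCoords]))) hp θ
  · exact (hI hk).pd_eq_zero hopen hp θ

/-- Now `f` involves no `u_y`, while the equation is affine in it. Increasing `u_y` by 1 adds `i/v`
times the field `r w`, which therefore kills `f`. -/
theorem isRiccatiInvariant_sqrtRatio_x (hopen : IsOpen Ω) (hf : IsSmoothOn Ω l f)
    (hx : ∀ p ∈ equationOver Ω, ∀ θ, DxL η₁ η₂ l f p θ = 0)
    (hy : ∀ p ∈ equationOver Ω, ∀ θ, DyL η₁ η₂ l f p θ = 0) {p : Coord → ℝ}
    (hp : p ∈ equationOver Ω) (hne : p (.v 0) ≠ 0) :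
    IsRiccatiInvariant (f p) 0 (sqrtRatioSeries (η₂ (p .y)) (η₁ (p .x))) 0 := by
  intro θ
  have hk : Coord.uy 0 ∉ baseCoords := by simp [baseCoords]
  have hI := indepOn_of_notMem_baseCoords hopen hf hx hy hk
  set p' := Function.update p (.uy 0) (p (.uy 0) + 1) with hp'
  have hpM : p' ∈ equationOver Ω := update_mem_equationOver hp hk _
  have h1 := hx p hp θ
  have h2 := hx p' hpM θ
  rw [DxL_eq_of_pd_eq_zero hf hp fun k h h' => pd_eq_zero_of_ne hopen hf hx hy h h' hp θ,
    thetaDot_riccatiX] at h1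
  rw [DxL_eq_of_pd_eq_zero hf hpM fun k h h' => pd_eq_zero_of_ne hopen hf hx hy h h' hpM θ,
    thetaDot_riccatiX, hI p hp _ hpM, hI.pd_update hopen hk hp] at h2
  have e : ∀ k, k ≠ .uy 0 → p' k = p k := fun k hk => Function.update_of_ne hk _ _
  have e0 : p' (.uy 0) = p (.uy 0) + 1 := Function.update_self _ _ _
  rw [e .x (by simp), e .y (by simp), e (.u 0) (by simp), e (.v 0) (by simp), e0] at h2
  refine map_riccatiField_eq_zero_of_shift (k := Complex.I / (p (.v 0) : ℝ)) ?_ h1 h2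
    (by simp) ?_ (by simp)
  · exact div_ne_zero (by simp) (Complex.ofReal_ne_zero.mpr hne)
  · rw [← add_mul, ← map_add]
    congr 2
    push_cast
    ring

theorem isRiccatiInvariant_sqrtRatio_y (hopen : IsOpen Ω) (hf : IsSmoothOn Ω l f)
    (hx : ∀ p ∈ equationOver Ω, ∀ θ, DxL η₁ η₂ l f p θ = 0)
    (hy : ∀ p ∈ equationOver Ω, ∀ θ, DyL η₁ η₂ l f p θ = 0) {p : Coord → ℝ}
    (hp : p ∈ equationOver Ω) (hne : p (.u 0) ≠ 0) :
    IsRiccatiInvariant (f p) 0 (sqrtRatioSeries (η₁ (p .x)) (η₂ (p .y))) 0 := by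
  intro θ
  have hk : Coord.vx 0 ∉ baseCoords := by simp [baseCoords]
  have hI := indepOn_of_notMem_baseCoords hopen hf hx hy hk
  set p' := Function.update p (.vx 0) (p (.vx 0) + 1) with hp'
  have hpM : p' ∈ equationOver Ω := update_mem_equationOver hp hk _
  have h1 := hy p hp θ
  have h2 := hy p' hpM θ
  rw [DyL_eq_of_pd_eq_zero hf hp fun k h h' => pd_eq_zero_of_ne hopen hf hx hy h h' hp θ,
    thetaDot_riccatiY] at h1
  rw [DyL_eq_of_pd_eq_zero hf hpM fun k h h' => pd_eq_zero_of_ne hopen hf hx hy h h' hpM θ,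
    thetaDot_riccatiY, hI p hp _ hpM, hI.pd_update hopen hk hp] at h2
  have e : ∀ k, k ≠ .vx 0 → p' k = p k := fun k hk => Function.update_of_ne hk _ _
  have e0 : p' (.vx 0) = p (.vx 0) + 1 := Function.update_self _ _ _
  rw [e .x (by simp), e .y (by simp), e (.u 0) (by simp), e (.v 0) (by simp), e0] at h2
  refine map_riccatiField_eq_zero_of_shift (k := -Complex.I / (p (.u 0) : ℝ)) ?_ h1 h2
    (by simp) ?_ (by simp)
  · exact div_ne_zero (by simp) (Complex.ofReal_ne_zero.mpr hne)
  · rw [← add_mul, ← map_add]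
    congr 2
    push_cast
    ring

/-- The varied parameter is now `u`, which `Ω` restricts; hence the small change from
`exists_update_eq` instead of a shift by 1. -/
theorem isRiccatiInvariant_invSqrt_x (hopen : IsOpen Ω) (hf : IsSmoothOn Ω l f)
    (hx : ∀ p ∈ equationOver Ω, ∀ θ, DxL η₁ η₂ l f p θ = 0)
    (hy : ∀ p ∈ equationOver Ω, ∀ θ, DyL η₁ η₂ l f p θ = 0) {p : Coord → ℝ}
    (hp : p ∈ equationOver Ω) :
    IsRiccatiInvariant (f p) (PowerSeries.X * invSqrtSeries (η₁ (p .x))) 0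
      ((PowerSeries.X * invSqrtSeries (η₁ (p .x)))) := by
  intro θ
  obtain ⟨t, ht, hpM, hft, hpdt⟩ := exists_update_eq hopen hf (b := .x) (c := .u 0) (by simp)
    (fun p hp θ => pd_eq_zero_of_ne hopen hf hx hy (by simp) (by simp) hp θ) hp
  set p' := Function.update p (.u 0) t with hp'
  have h1 := hx p hp θ
  have h2 := hx p' hpM θ
  rw [DxL_eq_of_pd_eq_zero hf hp fun k h h' => pd_eq_zero_of_ne hopen hf hx hy h h' hp θ,
    thetaDot_riccatiX] at h1
  rw [DxL_eq_of_pd_eq_zero hf hpM fun k h h' => pd_eq_zero_of_ne hopen hf hx hy h h' hpM θ,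
    thetaDot_riccatiX, hft, hpdt] at h2
  have e : ∀ k, k ≠ .u 0 → p' k = p k := fun k hk => Function.update_of_ne hk _ _
  have e0 : p' (.u 0) = t := Function.update_self _ _ _
  rw [e .x (by simp), e .y (by simp), e (.v 0) (by simp), e (.uy 0) (by simp),
    e0] at h2
  have hk : ((t - p (.u 0) : ℝ) : ℂ) ≠ 0 := Complex.ofReal_ne_zero.mpr (sub_ne_zero.mpr ht)
  refine map_riccatiField_eq_zero_of_shift (k := 1 * ((t - p (.u 0) : ℝ) : ℂ) / 2)
    (by simpa using hk) h1 h2 ?_ (by simp) ?_ <;>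
  · rw [← add_mul, ← map_add]
    congr 2
    push_cast
    ring

theorem isRiccatiInvariant_invSqrt_y (hopen : IsOpen Ω) (hf : IsSmoothOn Ω l f)
    (hx : ∀ p ∈ equationOver Ω, ∀ θ, DxL η₁ η₂ l f p θ = 0)
    (hy : ∀ p ∈ equationOver Ω, ∀ θ, DyL η₁ η₂ l f p θ = 0) {p : Coord → ℝ}
    (hp : p ∈ equationOver Ω) :
    IsRiccatiInvariant (f p) (PowerSeries.X * invSqrtSeries (η₂ (p .y))) 0
      (-(PowerSeries.X * invSqrtSeries (η₂ (p .y)))) := by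
  intro θ
  obtain ⟨t, ht, hpM, hft, hpdt⟩ := exists_update_eq hopen hf (b := .y) (c := .v 0) (by simp)
    (fun p hp θ => pd_eq_zero_of_ne hopen hf hx hy (by simp) (by simp) hp θ) hp
  set p' := Function.update p (.v 0) t with hp'
  have h1 := hy p hp θ
  have h2 := hy p' hpM θ
  rw [DyL_eq_of_pd_eq_zero hf hp fun k h h' => pd_eq_zero_of_ne hopen hf hx hy h h' hp θ,
    thetaDot_riccatiY] at h1
  rw [DyL_eq_of_pd_eq_zero hf hpM fun k h h' => pd_eq_zero_of_ne hopen hf hx hy h h' hpM θ,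
    thetaDot_riccatiY, hft, hpdt] at h2
  have e : ∀ k, k ≠ .v 0 → p' k = p k := fun k hk => Function.update_of_ne hk _ _
  have e0 : p' (.v 0) = t := Function.update_self _ _ _
  rw [e .x (by simp), e .y (by simp), e (.u 0) (by simp), e (.vx 0) (by simp),
    e0] at h2
  have hk : ((t - p (.v 0) : ℝ) : ℂ) ≠ 0 := Complex.ofReal_ne_zero.mpr (sub_ne_zero.mpr ht)
  refine map_riccatiField_eq_zero_of_shift (k := Complex.I * ((t - p (.v 0) : ℝ) : ℂ) / 2)
    (by simpa using hk) h1 h2 ?_ (by simp) ?_ <;>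
  · rw [← add_mul, ← map_add]
    congr 2
    push_cast
    ring

theorem fderiv_eq_zero_of_solution (hopen : IsOpen Ω) (hf : IsSmoothOn Ω l f)
    (hΩ : ∀ x y u v : ℝ, (x, y, u, v) ∈ Ω → u ≠ 0 ∧ v ≠ 0 ∧ η₁ x ≠ η₂ y)
    (hx : ∀ p ∈ equationOver Ω, ∀ θ, DxL η₁ η₂ l f p θ = 0)
    (hy : ∀ p ∈ equationOver Ω, ∀ θ, DyL η₁ η₂ l f p θ = 0) {p : Coord → ℝ}
    (hp : p ∈ equationOver Ω) (θ : Fin (l + 1) → ℂ) : fderiv ℂ (f p) θ = 0 := by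
  obtain ⟨hu, hv, hη⟩ := hΩ _ _ _ _ hp
  obtain ⟨q, hq, hq0⟩ := sqrtRatioSeries_sub (η₂ (p .y)) (η₁ (p .x))
  refine fderiv_eq_zero_of_isRiccatiInvariant (hf.holomorphic p hp)
    (by exact_mod_cast contDiff_infty.mp (hf.contDiff hopen hp) 2)
    (constantCoeff_sqrtRatioSeries _ _) hq ?_ (constantCoeff_invSqrtSeries _) (constantCoeff_invSqrtSeries _)
    (isRiccatiInvariant_sqrtRatio_x hopen hf hx hy hp hv)
    (isRiccatiInvariant_sqrtRatio_y hopen hf hx hy hp hu)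
    (isRiccatiInvariant_invSqrt_x hopen hf hx hy hp)
    (isRiccatiInvariant_invSqrt_y hopen hf hx hy hp) θ
  rw [hq0]
  exact Complex.ofReal_ne_zero.mpr (sub_ne_zero.mpr hη.symm)

/-- All partial derivatives of a solution vanish. -/
theorem pd_eq_zero_of_solution (hopen : IsOpen Ω) (hf : IsSmoothOn Ω l f)
    (hΩ : ∀ x y u v : ℝ, (x, y, u, v) ∈ Ω → u ≠ 0 ∧ v ≠ 0 ∧ η₁ x ≠ η₂ y)
    (hx : ∀ p ∈ equationOver Ω, ∀ θ, DxL η₁ η₂ l f p θ = 0)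
    (hy : ∀ p ∈ equationOver Ω, ∀ θ, DyL η₁ η₂ l f p θ = 0) (k : Coord) {p : Coord → ℝ}
    (hp : p ∈ equationOver Ω) (θ : Fin (l + 1) → ℂ) : pd k (fun q => f q θ) p = 0 := by
  have hpd : ∀ k, k ≠ .x → k ≠ .y → pd k (fun q => f q θ) p = 0 :=
    fun k h h' => pd_eq_zero_of_ne hopen hf hx hy h h' hp θ
  have hθ := fderiv_eq_zero_of_solution hopen hf hΩ hx hy hp θ
  by_cases hkx : k = .x
  · have := hx p hp θ
    rw [DxL_eq_of_pd_eq_zero hf hp hpd, hθ] at this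
    simpa [hkx] using this
  by_cases hky : k = .y
  · have := hy p hp θ
    rw [DyL_eq_of_pd_eq_zero hf hp hpd, hθ] at this
    simpa [hky] using this
  exact hpd k hkx hky

/-! ### Passage to constants -/

/-- The point with given `x, y, u, v` at which all derivatives vanish. -/
def basePoint (z : ℝ × ℝ × ℝ × ℝ) : Coord → ℝ
  | .x => z.1
  | .y => z.2.1
  | .u 0 => z.2.2.1
  | .v 0 => z.2.2.2
  | _ => 0

theorem contDiff_basePoint (k : Coord) : ContDiff ℝ ∞ (fun z => basePoint z k) := by
  match k with
  | .x => exact contDiff_fst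
  | .y => exact contDiff_fst.comp contDiff_snd
  | .u 0 => exact contDiff_fst.comp (contDiff_snd.comp contDiff_snd)
  | .v 0 => exact contDiff_snd.comp (contDiff_snd.comp contDiff_snd)
  | .u (n + 1) => exact contDiff_const
  | .v (n + 1) => exact contDiff_const
  | .uy n => exact contDiff_const
  | .vx n => exact contDiff_const

/-- Only the finitely many coordinates in `K` matter. They are changed from `p` to `q` one at a
time, and every intermediate point lies over `Ω` because the base coordinates never change. -/
theorem eq_of_eqOn_baseCoords (hf : IsSmoothOn Ω l f)
    (hI : ∀ k, k ∉ baseCoords → IndepOn Ω f k) {p q : Coord → ℝ} (hp : p ∈ equationOver Ω)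
    (hpq : ∀ k ∈ baseCoords, p k = q k) : f p = f q := by
  obtain ⟨K, hK, -⟩ := hf.finite_order
  have hmem : ∀ T : Finset Coord, T.piecewise q p ∈ equationOver Ω := fun T =>
    mem_equationOver_congr (fun k hk => by by_cases h : k ∈ T <;> simp [h, hpq k hk]) hp
  have hT : ∀ T : Finset Coord, f (T.piecewise q p) = f p := by
    intro T
    induction T using Finset.induction_on with
    | empty => simp
    | insert k T hk ih =>
      have hm := hmem (insert k T)
      rw [Finset.piecewise_insert] at hm ⊢
      by_cases hb : k ∈ baseCoords
      · have : (T.piecewise q p) k = q k := by simp [hk, hpq k hb]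
        rw [← this, Function.update_eq_self, ih]
      · rw [hI k hb _ (hmem T) _ hm, ih]
  rw [← hT K]
  exact hK _ (hmem K) _ (mem_equationOver_congr hpq hp) fun k hk => by simp [hk]

theorem basePoint_mem {z : ℝ × ℝ × ℝ × ℝ} : basePoint z ∈ equationOver Ω ↔ z ∈ Ω := Iff.rfl

theorem exists_const_of_pd_eq_zero (hopen : IsOpen Ω) (hconn : IsPreconnected Ω)
    (hf : IsSmoothOn Ω l f)
    (hpd : ∀ k, ∀ p ∈ equationOver Ω, ∀ θ, pd k (fun q => f q θ) p = 0)
    (hθ : ∀ p ∈ equationOver Ω, ∀ θ, fderiv ℂ (f p) θ = 0) :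
    ∃ c : ℂ, ∀ p ∈ equationOver Ω, ∀ θ : Fin (l + 1) → ℂ, f p θ = c := by
  set F : ℝ × ℝ × ℝ × ℝ → ℂ := fun z => f (basePoint z) 0 with hF
  have hd : ∀ z ∈ Ω, DifferentiableAt ℝ F z := fun z hz =>
    (hf.contDiffAt_comp hopen (fun k => (contDiff_basePoint k).contDiffAt)
      contDiffAt_const (basePoint_mem.mpr hz)).differentiableAt (by simp)
  -- Transfers `pd k f = 0` to a directional derivative of `F`, via a coordinate line `γ` in the
  -- base. The four axis directions then span.
  have hdir : ∀ z ∈ Ω, ∀ (k : Coord) (γ : ℝ → ℝ × ℝ × ℝ × ℝ) (e : ℝ × ℝ × ℝ × ℝ),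
      (∀ t, basePoint (γ t) = Function.update (basePoint z) k t) → γ (basePoint z k) = z →
      HasDerivAt γ e (basePoint z k) → fderiv ℝ F z e = 0 := by
    intro z hz k γ e hγ hγz he
    have h1 : HasFDerivAt F (fderiv ℝ F z) (γ (basePoint z k)) := by
      rw [hγz]; exact (hd z hz).hasFDerivAt
    have h2 := (h1.comp_hasDerivAt (basePoint z k) he).deriv
    rw [← h2]
    have h3 := hpd k _ (basePoint_mem.mpr hz) 0
    rw [pd] at h3
    rw [← h3]
    congr 1
    funext t
    simp [hF, hγ]
  have hzero : Ω.EqOn (fderiv ℝ F) 0 := by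
    rintro ⟨x, y, u, v⟩ hz
    have e1 := hdir _ hz .x (fun t => (t, y, u, v)) (1, 0, 0, 0)
      (fun t => by funext k; rcases k with _ | _ | (_ | n) | n | (_ | n) | n <;> simp [basePoint])
      rfl ((hasDerivAt_id _).prodMk (hasDerivAt_const _ _))
    have e2 := hdir _ hz .y (fun t => (x, t, u, v)) (0, 1, 0, 0)
      (fun t => by funext k; rcases k with _ | _ | (_ | n) | n | (_ | n) | n <;> simp [basePoint])
      rfl ((hasDerivAt_const _ _).prodMk ((hasDerivAt_id _).prodMk (hasDerivAt_const _ _)))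
    have e3 := hdir _ hz (.u 0) (fun t => (x, y, t, v)) (0, 0, 1, 0)
      (fun t => by funext k; rcases k with _ | _ | (_ | n) | n | (_ | n) | n <;> simp [basePoint])
      rfl ((hasDerivAt_const _ _).prodMk ((hasDerivAt_const _ _).prodMk
        ((hasDerivAt_id _).prodMk (hasDerivAt_const _ _))))
    have e4 := hdir _ hz (.v 0) (fun t => (x, y, u, t)) (0, 0, 0, 1)
      (fun t => by funext k; rcases k with _ | _ | (_ | n) | n | (_ | n) | n <;> simp [basePoint])
      rfl ((hasDerivAt_const _ _).prodMk ((hasDerivAt_const _ _).prodMk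
        ((hasDerivAt_const _ _).prodMk (hasDerivAt_id _))))
    refine ContinuousLinearMap.ext ?_
    rintro ⟨a, b, c, d⟩
    have : ((a, b, c, d) : ℝ × ℝ × ℝ × ℝ) = a • (1, 0, 0, 0) + b • (0, 1, 0, 0)
        + c • (0, 0, 1, 0) + d • (0, 0, 0, 1) := by simp
    rw [this, map_add, map_add, map_add, map_smul, map_smul, map_smul, map_smul, e1, e2, e3, e4]
    simp
  obtain ⟨c, hc⟩ := hopen.exists_is_const_of_fderiv_eq_zero hconn
    (fun z hz => (hd z hz).differentiableWithinAt) hzero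
  refine ⟨c, fun p hp θ => ?_⟩
  have h1 : f p θ = f p 0 := is_const_of_fderiv_eq_zero (hf.holomorphic p hp) (hθ p hp) θ 0
  have h2 : f p = f (basePoint (p .x, p .y, p (.u 0), p (.v 0))) := by
    refine eq_of_eqOn_baseCoords hf (fun k hk => hf.indepOn hopen hk (hpd k)) hp ?_
    rintro k (rfl | rfl | rfl | rfl) <;> rfl
  rw [h1, h2]
  exact hc _ hp

/-- Constancy is known only over `Ω`; openness is what lets it determine the derivatives. -/
theorem pd_eq_zero_of_const (hopen : IsOpen Ω) {c : ℂ}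
    (hc : ∀ p ∈ equationOver Ω, ∀ θ, f p θ = c) (k : Coord) {p : Coord → ℝ}
    (hp : p ∈ equationOver Ω) (θ : Fin (l + 1) → ℂ) : pd k (fun q => f q θ) p = 0 :=
  IndepOn.pd_eq_zero hopen (fun q hq _ ht => funext fun θ => by rw [hc _ ht, hc q hq]) hp θ

end Solutions

end SDeformable

end

theorem mainTheorem1 (η₁ η₂ : ℝ → ℝ) (Ω : Set (ℝ × ℝ × ℝ × ℝ))
    (hopen : IsOpen Ω) (hconn : IsPreconnected Ω)
    (hη : ∀ x y u v : ℝ, (x, y, u, v) ∈ Ω → ContDiffAt ℝ ∞ η₁ x ∧ ContDiffAt ℝ ∞ η₂ y)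
    (hΩ : ∀ x y u v : ℝ, (x, y, u, v) ∈ Ω → u ≠ 0 ∧ v ≠ 0 ∧ η₁ x ≠ η₂ y)
    (l : ℕ) (f : (SDeformable.Coord → ℝ) → (Fin (l + 1) → ℂ) → ℂ)
    (hf : SDeformable.IsSmoothOn Ω l f) :
    (∀ p ∈ SDeformable.equationOver Ω, ∀ θ : Fin (l + 1) → ℂ,
        SDeformable.DxL η₁ η₂ l f p θ = 0 ∧ SDeformable.DyL η₁ η₂ l f p θ = 0) ↔
      ∃ c : ℂ, ∀ p ∈ SDeformable.equationOver Ω, ∀ θ : Fin (l + 1) → ℂ, f p θ = c := by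
  constructor
  · intro h
    have hx := fun p hp θ => (h p hp θ).1
    have hy := fun p hp θ => (h p hp θ).2
    exact SDeformable.exists_const_of_pd_eq_zero hopen hconn hf
      (fun k p hp θ => SDeformable.pd_eq_zero_of_solution hopen hf hΩ hx hy k hp θ)
      (fun p hp θ => SDeformable.fderiv_eq_zero_of_solution hopen hf hΩ hx hy hp θ)
  · rintro ⟨c, hc⟩ p hp θ
    have hpd := fun k => SDeformable.pd_eq_zero_of_const hopen hc k hp θ
    have hcp : f p = fun _ => c := funext (hc p hp)
    constructor
    · rw [SDeformable.DxL_eq_of_pd_eq_zero hf hp fun k _ _ => hpd k, hpd, hcp]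
      simp
    · rw [SDeformable.DyL_eq_of_pd_eq_zero hf hp fun k _ _ => hpd k, hpd, hcp]
      simp
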